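/- Consider an episodic, finite, two-player, zero-sum imperfect information game of length $H\ge 1$: a finite state set $\mathcal S$; two partitions $\mathcal X$, $\mathcal Y$ of $\mathcal S$ into information sets of the max- and min-player; finite action sets $\mathcal A(x)$, $\mathcal B(y)$ of sizes $A(x)$, $B(y)$; an initial distribution $p_0$; transition kernels $p_h(\cdot\mid s,a,b)$, $1\le h\le H-1$; and rewards $r_h(s,a,b)\in[0,1]$. Assume perfect recall: each $x\in\mathcal X$ is reached, with positive transition probabilities, through exactly one history $(x_1,a_1,\dots,x_{h-1},a_{h-1},x_h=x)$. Let $\mathcal X_h$ be the set of information sets of depth $h$, $\mathcal A\mathcal X_h=\{(x_h,a_h): x_h\in\mathcal X_h,\ a_h\in\mathcal A(x_h)\}$, and $A_{\mathcal X}=\sum_{x}A(x)$. A policy of the max-player is $\mu=(\mu_h(\cdot\mid x_h))_{x_h}$ with $\mu_h(\cdot\mid x_h)$ a probability distribution on $\mathcal A(x_h)$; its realization plan is $\mu_{1:h}(x_h,a_h)=\prod_{h'\le h}\mu_{h'}(a_{h'}\mid x_{h'})$ along the history. Policies $\nu$ of the min-player are defined similarly, and $V^{\mu,\nu}=\mathbb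 E^{\mu,\nu}\big[\sum_{h=1}^H r_h\big]$. $T$ episodes are played. The policies $\mu^t,\nu^t$ used in episode $t$ depend only on what happened before it (the min-player is otherwise arbitrary), and given the past the run of episode $t$ has the law induced by $(\mu^t,\nu^t)$; $(x_h^t,a_h^t,r_h^t)$ denote the information set, action and reward of the max-player at its step $h$. The regret is $$\mathfrak R^T_{\max}=\max_{\mu^\dagger}\sum_{t=1}^T\big(V^{\mu^\dagger,\nu^t}-V^{\mu^t,\nu^t}\big).$$ *Balanced transitions.* For $x\in\mathcal X$ let $A^\tau(x)=\sum_{x'\ge x}A(x')$, the sum being over $x$ and all information sets whose history contains $x$. Put $p^\star_0(x_1)=A^\tau(x_1)/A_{\mathcal X}$ for $x_1\in\mathcal X_1$, $p^\star_h(x_{h+1}\mid x_h,a_h)=A^\tau(x_{h+1})/\sum_{x'}A^\tau(x')$, the sum being over the information sets $x'$ of depth $h+1$ that follow $(x_h,a_h)$, and $p^\star_{1:h}(x_h)=p^\star_0(x_1)\prod_{h'<h}p^\star_{h'}(x_{h'+1}\mid x_{h'},a_{h'})$. *Balanced-FTRL* with regularizers $\Psi_h$, learning rates $\eta_h$ and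 IX parameters $\gamma_h$ plays $$\mu^t\in\operatorname*{argmin}_{\mu}\ \sum_{h=1}^H\sum_{(x_h,a_h)\in\mathcal A\mathcal X_h}\mu_{1:h}(x_h,a_h)\sum_{k<t}\tilde\ell^k_h(x_h,a_h)+\sum_{h=1}^H\frac{1}{\eta_h}\Psi_h\big(p^\star_{1:h}\cdot\mu_{1:h}\big),$$ $$\tilde\ell^t_h(x_h,a_h)=\frac{\mathbf 1\{x^t_h=x_h,\ a^t_h=a_h\}}{\mu^t_{1:h}(x_h,a_h)+\gamma_h/p^\star_{1:h}(x_h)}\,(1-r^t_h),$$ where $(p^\star_{1:h}\cdot\mu_{1:h})(x_h,a_h)=p^\star_{1:h}(x_h)\mu_{1:h}(x_h,a_h)$. The Tsallis version with exponent $q$ uses $\Psi_h(w)=-\sum_{(x_h,a_h)\in\mathcal A\mathcal X_h}w(x_h,a_h)^q$ and the Shannon version uses $\Psi_h(w)=\sum_{(x_h,a_h)\in\mathcal A\mathcal X_h}w(x_h,a_h)\log w(x_h,a_h)$. **Theorem.** Let $\delta\in(0,1)$, $\iota=\log(3A_{\mathcal X}/\delta)$ and $\gamma_h=\sqrt{H\iota/(2A_{\mathcal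 X}T)}$ for all $h$. 1. If the max-player runs Balanced-FTRL with the Tsallis regularizer, $q\in(0,1)$, and the constant learning rates $\eta_h=\sqrt{2q(1-q)/T}\,(H/A_{\mathcal X})^{q-1/2}$, then with probability at least $1-\delta$, $$\mathfrak R^T_{\max}\le\Big(\sqrt{2/(q(1-q))}+3\sqrt{2\iota}\Big)\sqrt{HA_{\mathcal X}T}.$$ 2. If the max-player runs Balanced-FTRL with the Shannon regularizer and the constant learning rates $\eta_h=\sqrt{2H\log(A_{\mathcal X})/(A_{\mathcal X}T)}$, then with probability at least $1-\delta$, $$\mathfrak R^T_{\max}\le\Big(\sqrt{2\log A_{\mathcal X}}+3\sqrt{2\iota}\Big)\sqrt{HA_{\mathcal X}T}.$$ -/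

import Mathlib

open MeasureTheory ProbabilityTheory

noncomputable section

/-- Behavioural policies for the action sets `A x`, `x` ranging over information sets:
a probability vector on `A x` for every `x`. -/
def Policies {X : Type*} (A : X → Type*) [∀ x, Fintype (A x)] : Set (∀ x, A x → ℝ) :=
  {μ | ∀ x, μ x ∈ stdSimplex ℝ (A x)}

/-- An episodic, finite, two-player, zero-sum imperfect information game. The maps `xinfo` and
`yinfo` send a state to its information set for the max- and the min-player (the partitions of the
state space). Steps are numbered `0, …, H - 1`; `p h` is the transition kernel from step `h` to
step `h + 1`. -/
structure IIG (S X Y : Type*) [Fintype S] (A : X → Type*) (B : Y → Type*) where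
  H : ℕ
  H_pos : 0 < H
  xinfo : S → X
  yinfo : S → Y
  xinfo_surj : Function.Surjective xinfo
  yinfo_surj : Function.Surjective yinfo
  p0 : S → ℝ
  p0_mem : p0 ∈ stdSimplex ℝ S
  p : ℕ → (s : S) → A (xinfo s) → B (yinfo s) → S → ℝ
  p_mem : ∀ h, h + 1 < H → ∀ s a b, p h s a b ∈ stdSimplex ℝ S
  r : ℕ → (s : S) → A (xinfo s) → B (yinfo s) → ℝ
  r_mem : ∀ h, h < H → ∀ s a b, r h s a b ∈ Set.Icc (0 : ℝ) 1

namespace IIG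

variable {S X Y : Type*} [Fintype S] {A : X → Type*} {B : Y → Type*}

/-- What happens at one step: a state and a legal action of each player. -/
abbrev Step (G : IIG S X Y A B) : Type _ :=
  Σ s : S, A (G.xinfo s) × B (G.yinfo s)

/-- The pair (information set, action) of the max-player at a step. -/
def obs (G : IIG S X Y A B) (c : G.Step) : Σ x, A x := ⟨G.xinfo c.1, c.2.1⟩

/-- `G.Path l s`: the state `s` can be reached with positive probability through the
steps listed in `l`, most recent step first. -/
inductive Path (G : IIG S X Y A B) : List G.Step → S → Prop
  | root (s : S) (hs : 0 < G.p0 s) : Path G [] s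
  | next (l : List G.Step) (s : S) (a : A (G.xinfo s)) (b : B (G.yinfo s)) (s' : S)
      (hl : Path G l s) (hH : l.length + 1 < G.H) (hp : 0 < G.p l.length s a b s') :
      Path G (⟨s, a, b⟩ :: l) s'

/-- `l = [(x_{h-1}, a_{h-1}), …, (x_1, a_1)]` (most recent first) is a possible history of the
max-player that leads to the information set `x`. -/
def IsHistory (G : IIG S X Y A B) (l : List (Σ x, A x)) (x : X) : Prop :=
  ∃ path s, G.Path path s ∧ G.xinfo s = x ∧ path.map G.obs = l

/-- Perfect recall of the max-player: each information set has exactly one history. -/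
def PerfectRecall (G : IIG S X Y A B) : Prop :=
  ∀ x, ∃! l, G.IsHistory l x

/-- The history of `x` (the unique one, under perfect recall), most recent pair first. -/
def hist (G : IIG S X Y A B) (x : X) : List (Σ x, A x) :=
  Classical.epsilon fun l => G.IsHistory l x

/-- The step, in `0, …, H - 1`, at which `x` can be visited. -/
def depth (G : IIG S X Y A B) (x : X) : ℕ := (G.hist x).length

/-- Realization plan: the product of the probabilities, under `μ`, of the actions on the
history of `z.1` and of the action `z.2`. -/
def plan (G : IIG S X Y A B) (μ : ∀ x, A x → ℝ) (z : Σ x, A x) : ℝ :=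
  ((G.hist z.1).map fun w => μ w.1 w.2).prod * μ z.1 z.2

section Episode

variable [∀ x, Fintype (A x)] [∀ y, Fintype (B y)]

/-- A complete run of one episode. -/
abbrev Traj (G : IIG S X Y A B) : Type _ := Fin G.H → G.Step

/-- Probability of the run `τ` when the players use `μ` and `ν`. -/
def trajProb (G : IIG S X Y A B) (μ : ∀ x, A x → ℝ) (ν : ∀ y, B y → ℝ) (τ : G.Traj) : ℝ :=
  G.p0 (τ ⟨0, G.H_pos⟩).1 *
    (∏ h : Fin G.H, μ (G.xinfo (τ h).1) (τ h).2.1 * ν (G.yinfo (τ h).1) (τ h).2.2) *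
    ∏ h : Fin (G.H - 1),
      G.p h (τ ⟨h, by omega⟩).1 (τ ⟨h, by omega⟩).2.1 (τ ⟨h, by omega⟩).2.2
        (τ ⟨h + 1, by omega⟩).1

/-- Reward of the max-player at step `h` of the run `τ`. -/
def reward (G : IIG S X Y A B) (τ : G.Traj) (h : Fin G.H) : ℝ :=
  G.r h (τ h).1 (τ h).2.1 (τ h).2.2

/-- Expected total reward of the max-player. -/
def value (G : IIG S X Y A B) (μ : ∀ x, A x → ℝ) (ν : ∀ y, B y → ℝ) : ℝ :=
  ∑ τ : G.Traj, G.trajProb μ ν τ * ∑ h, G.reward τ h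

/-- Regret of the max-player after `T` episodes (numbered `0, …, T - 1`). -/
def regretMax (G : IIG S X Y A B) (T : ℕ)
    (μ : ℕ → ∀ x, A x → ℝ) (ν : ℕ → ∀ y, B y → ℝ) : ℝ :=
  ⨆ μd : Policies A, ∑ t ∈ Finset.range T, (G.value μd (ν t) - G.value (μ t) (ν t))

/-- The interaction over `T` episodes. The policies of both players in episode `t` are functions
of what happened before (`ℱ t` is the information available before episode `t`; it contains the
previous runs, and possibly more, such as private randomness), and given this information the run
`τ t` of episode `t` has the law induced by the two policies. -/
structure IsLearning (G : IIG S X Y A B) {Ω : Type*} {mΩ : MeasurableSpace Ω}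
    (P : Measure Ω) (ℱ : Filtration ℕ mΩ) (T : ℕ) (μ : ℕ → Ω → ∀ x, A x → ℝ)
    (ν : ℕ → Ω → ∀ y, B y → ℝ) (τ : ℕ → Ω → G.Traj) : Prop where
  max_policy : ∀ t < T, ∀ ω, μ t ω ∈ Policies A
  min_policy : ∀ t < T, ∀ ω, ν t ω ∈ Policies B
  max_predictable : ∀ t < T, Measurable[ℱ t] (μ t)
  min_predictable : ∀ t < T, Measurable[ℱ t] (ν t)
  run_adapted : ∀ t < T, ∀ σ, MeasurableSet[ℱ (t + 1)] {ω | τ t ω = σ}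
  run_law : ∀ t < T, ∀ σ,
    P[Set.indicator {ω | τ t ω = σ} (fun _ => (1 : ℝ)) | ℱ t]
      =ᵐ[P] fun ω => G.trajProb (μ t ω) (ν t ω) σ

end Episode

section Algorithm

open scoped Classical

variable [Fintype X] [∀ x, Fintype (A x)]

/-- Total number `A_X` of pairs (information set, action) of the max-player. -/
def AX (_G : IIG S X Y A B) : ℕ := Fintype.card (Σ x, A x)

/-- Total number of actions in the sub-tree of `x`, that is, at the information sets `x'`
such that `x' = x` or `x` is on the history of `x'`. -/
def Atau (G : IIG S X Y A B) (x : X) : ℝ :=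
  ∑ x' : X with x' = x ∨ ∃ a : A x, (⟨x, a⟩ : Σ x, A x) ∈ G.hist x', (Fintype.card (A x') : ℝ)

/-- The information sets that immediately follow the pair `z`. -/
def children (G : IIG S X Y A B) (z : Σ x, A x) : Finset X :=
  {x | G.hist x = z :: G.hist z.1}

/-- Balanced transition from the pair `z` to an information set `x` that follows it. -/
def balStep (G : IIG S X Y A B) (z : Σ x, A x) (x : X) : ℝ :=
  G.Atau x / ∑ x' ∈ G.children z, G.Atau x'

/-- Product of the balanced transitions along a history (most recent pair first) that
leads to `x`, starting with the balanced root distribution. -/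
def balAlong (G : IIG S X Y A B) : List (Σ x, A x) → X → ℝ
  | [], x => G.Atau x / G.AX
  | w :: l, x => G.balAlong l w.1 * G.balStep w x

/-- The balanced probability `p^⋆_{1:h}(x)` for `x` of depth `h`. -/
def pstar (G : IIG S X Y A B) (x : X) : ℝ := G.balAlong (G.hist x) x

/-- Negative Tsallis entropy with exponent `q` at depth `h`. -/
def tsallis (G : IIG S X Y A B) (q : ℝ) (h : ℕ) (w : (Σ x, A x) → ℝ) : ℝ :=
  -∑ z : (Σ x, A x) with G.depth z.1 = h, w z ^ q

/-- Negative Shannon entropy at depth `h`. -/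
def shannon (G : IIG S X Y A B) (h : ℕ) (w : (Σ x, A x) → ℝ) : ℝ :=
  ∑ z : (Σ x, A x) with G.depth z.1 = h, w z * Real.log (w z)

/-- Objective of the policy update, for regularizers `Ψ h`, learning rates `η h` and a
cumulative loss vector `L`. -/
def objective (G : IIG S X Y A B) (Ψ : ℕ → ((Σ x, A x) → ℝ) → ℝ) (η : ℕ → ℝ)
    (L : (Σ x, A x) → ℝ) (μ : ∀ x, A x → ℝ) : ℝ :=
  ∑ z, G.plan μ z * L z +
    ∑ h ∈ Finset.range G.H, Ψ h (fun z => G.pstar z.1 * G.plan μ z) / η h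

/-- Implicit-exploration loss estimate computed from the run `τ` of an episode played with `μ`,
with exploration parameter `γ h / p^⋆_{1:h}(x)` at an information set `x` of depth `h`. -/
def lossEst (G : IIG S X Y A B) (γ : ℕ → ℝ) (μ : ∀ x, A x → ℝ) (τ : G.Traj)
    (z : Σ x, A x) : ℝ :=
  ∑ h : Fin G.H, if (h : ℕ) = G.depth z.1 ∧ G.obs (τ h) = z then
    (1 - G.reward τ h) / (G.plan μ z + γ h / G.pstar z.1) else 0

/-- Sum of the loss estimates of the episodes before episode `t`. -/
def cumLoss (G : IIG S X Y A B) (γ : ℕ → ℝ) (μ : ℕ → ∀ x, A x → ℝ) (τ : ℕ → G.Traj) (t : ℕ)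
    (z : Σ x, A x) : ℝ :=
  ∑ k ∈ Finset.range t, G.lossEst γ (μ k) (τ k) z

/-- The policies `μ 0, …, μ (T - 1)` are those played by Balanced-FTRL with regularizers `Ψ h`,
learning rates `η h` and exploration parameters `γ h`, when the runs are `τ 0, τ 1, …`. -/
def IsBalancedFTRL (G : IIG S X Y A B) (Ψ : ℕ → ((Σ x, A x) → ℝ) → ℝ) (η γ : ℕ → ℝ) (T : ℕ)
    (μ : ℕ → ∀ x, A x → ℝ) (τ : ℕ → G.Traj) : Prop :=
  ∀ t < T, μ t ∈ Policies A ∧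
    IsMinOn (G.objective Ψ η (G.cumLoss γ μ τ t)) (Policies A) (μ t)

end Algorithm

end IIG

end

/-! Perfect recall turns the information sets of the max-player into a forest. The probability of a
run then splits into the realization plan at the visited pair and a factor that depends only on the
opponent and on chance, so `value` equals `H` minus a linear form ⟨plan, `lossVec`⟩. Regret thus
becomes online linear optimization over the convex set of realization plans.

The balanced weights w = p⋆ · plan form a probability vector at each depth, so they sum to `H`.
Conversely, ∑ loss / p⋆ ≤ A_X whatever the opponent does (`PerfectRecall.sum_lossVec_div_pstar_le`):
p⋆ splits mass in proportion to the sizes of the subtrees, and every subtree receives exactly the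
budget it can spend. These two facts produce all the factors H and A_X.

The regret splits into four terms: the bias of the implicit-exploration (IX) estimates along the
played policies, at most γ A_X T; the lower deviation of the estimated loss of the played policies,
at most 2γ A_X T; the FTRL regret on the estimates; and the overestimation of the comparator's loss,
at most γ A_X T. For the FTRL term, a one-sided strong convexity estimate gives the range of the
regularizer divided by η, plus (ηκ/2) ∑ w^(2-q) (est / p⋆)². Since plan · est ≤ 1, the square drops
to w^(1-q) est / p⋆. Replacing estimates by true losses costs another γ A_X T, and a power-mean
inequality bounds the rest by T A_X (H/A_X)^(1-q). The rate η balances the two main terms. If ηκ/2 ≤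
2 the errors add up to at most 6γ A_X T = 3√(2ι) √(H A_X T); otherwise the claimed bound already
exceeds H T and is trivial.

The deviations are controlled by exponential supermartingales: one event per pair, one per depth and
one for the played losses. That is A_X + H + 1 ≤ 3 A_X events, each failing with probability at most
exp(-ι) = δ / (3 A_X). -/

set_option linter.unusedSectionVars false

/-! ### Histories, the forest of information sets, and realization plans -/

namespace IIG

section History

variable {S X Y : Type*} [Fintype S] {A : X → Type*} {B : Y → Type*} {G : IIG S X Y A B}

theorem Path.length_lt {l : List G.Step} {s : S} (h : G.Path l s) : l.length < G.H := by
  cases h with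
  | root s hs => exact G.H_pos
  | next l s a b s' hl hH hp => simpa using hH

theorem PerfectRecall.isHistory_hist (hG : G.PerfectRecall) (x : X) : G.IsHistory (G.hist x) x :=
  Classical.epsilon_spec (hG x).exists

theorem PerfectRecall.hist_eq (hG : G.PerfectRecall) {x : X} {l : List (Σ x, A x)}
    (h : G.IsHistory l x) : G.hist x = l :=
  (hG x).unique (hG.isHistory_hist x) h

theorem PerfectRecall.hist_xinfo (hG : G.PerfectRecall) {l : List G.Step} {s : S}
    (h : G.Path l s) : G.hist (G.xinfo s) = l.map G.obs :=
  hG.hist_eq ⟨l, s, h, rfl, rfl⟩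

theorem PerfectRecall.depth_lt (hG : G.PerfectRecall) (x : X) : G.depth x < G.H := by
  obtain ⟨path, s, hp, -, hl⟩ := hG.isHistory_hist x
  rw [depth, ← hl, List.length_map]
  exact hp.length_lt

/-- Removing the latest step from a path that witnesses the history of `x` leaves a path to a state
of `w.1`; by uniqueness its observations are the history of `w.1`. This is the parent relation
behind the inductions on depth. -/
theorem PerfectRecall.hist_of_cons (hG : G.PerfectRecall) {x : X} {w : Σ x, A x}
    {l : List (Σ x, A x)} (h : G.hist x = w :: l) : G.hist w.1 = l := by
  obtain ⟨path, s, hp, -, hl⟩ := hG.isHistory_hist x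
  rw [h] at hl
  cases hp with
  | root s hs => simp at hl
  | next l' s a b s' hl' hH hp =>
    simp only [List.map_cons, List.cons.injEq] at hl
    obtain ⟨rfl, rfl⟩ := hl
    exact hG.hist_xinfo hl'

theorem PerfectRecall.suffix_of_mem (hG : G.PerfectRecall) {w : Σ x, A x} {x : X}
    (h : w ∈ G.hist x) : (w :: G.hist w.1) <:+ G.hist x := by
  induction hn : (G.hist x).length generalizing x with
  | zero => simp [List.eq_nil_of_length_eq_zero hn] at h
  | succ n ih =>
    obtain ⟨v, l, hl⟩ := List.exists_cons_of_length_eq_add_one hn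
    have hv := hG.hist_of_cons hl
    rw [hl] at h hn ⊢
    rcases List.mem_cons.1 h with rfl | h
    · rw [hv]
    · rw [← hv] at h ⊢
      exact (ih h (by simpa [hv] using hn)).trans (List.suffix_cons _ _)

/-- `x` is `x'` or lies on the history of `x'`. -/
def Anc (G : IIG S X Y A B) (x x' : X) : Prop :=
  x' = x ∨ ∃ a : A x, (⟨x, a⟩ : Σ x, A x) ∈ G.hist x'

theorem PerfectRecall.suffix_of_anc (hG : G.PerfectRecall) {x x' : X} (h : G.Anc x x') :
    G.hist x <:+ G.hist x' := by
  rcases h with rfl | ⟨a, ha⟩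
  · exact List.suffix_rfl
  · exact (List.suffix_cons _ _).trans (hG.suffix_of_mem ha)

theorem PerfectRecall.depth_lt_of_mem (hG : G.PerfectRecall) {w : Σ x, A x} {x : X}
    (h : w ∈ G.hist x) : G.depth w.1 < G.depth x := by
  have := (hG.suffix_of_mem h).length_le
  simpa [depth] using this

/-- Two pairs on one history give two suffixes of the same list; at equal depth these have equal
length and therefore coincide. -/
theorem PerfectRecall.anc_unique (hG : G.PerfectRecall) {c c' x : X}
    (hd : G.depth c = G.depth c') (h : G.Anc c x) (h' : G.Anc c' x) : c = c' := by
  rcases h with rfl | ⟨a, ha⟩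
  · rcases h' with rfl | ⟨a', ha'⟩
    · rfl
    · exact absurd (hG.depth_lt_of_mem ha') (by simp [hd])
  · rcases h' with rfl | ⟨a', ha'⟩
    · exact absurd (hG.depth_lt_of_mem ha) (by simp [hd])
    · have h1 := hG.suffix_of_mem ha
      have h2 := hG.suffix_of_mem ha'
      have h3 := (List.suffix_of_suffix_length_le h1 h2 (by simpa [depth] using hd.le)).eq_of_length
        (by simpa [depth] using hd)
      simp only [List.cons.injEq, Sigma.mk.injEq] at h3
      exact h3.1.1

theorem PerfectRecall.exists_root_anc (hG : G.PerfectRecall) (x : X) :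
    ∃ c, G.depth c = 0 ∧ G.Anc c x := by
  induction hn : (G.hist x).length generalizing x with
  | zero => exact ⟨x, hn, Or.inl rfl⟩
  | succ n ih =>
    obtain ⟨v, l, hl⟩ := List.exists_cons_of_length_eq_add_one hn
    have hv := hG.hist_of_cons hl
    obtain ⟨c, hc, hanc⟩ := ih v.1 (by rw [hv]; simpa [hl] using hn)
    refine ⟨c, hc, Or.inr ?_⟩
    rcases hanc with h | ⟨a, ha⟩
    · obtain ⟨v1, v2⟩ := v
      simp only at h
      subst h
      exact ⟨v2, by simp [hl]⟩
    · exact ⟨a, by rw [hl, ← hv]; exact List.mem_cons_of_mem _ ha⟩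

/-- The transition vector sums to one, so some successor has positive probability. This keeps
balanced mass from being lost before the horizon. -/
theorem PerfectRecall.exists_child [∀ y, Nonempty (B y)] (hG : G.PerfectRecall)
    (z : Σ x, A x) (hz : G.depth z.1 + 1 < G.H) : ∃ x, G.hist x = z :: G.hist z.1 := by
  obtain ⟨path, s, hp, hx, hl⟩ := hG.isHistory_hist z.1
  obtain ⟨x, a⟩ := z
  simp only at hx hl hz
  subst hx
  have hlen : path.length = G.depth (G.xinfo s) := by rw [depth, ← hl, List.length_map]
  obtain ⟨b⟩ : Nonempty (B (G.yinfo s)) := inferInstance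
  have hmem := G.p_mem path.length (by rwa [hlen]) s a b
  obtain ⟨s', hs'⟩ : ∃ s', 0 < G.p path.length s a b s' := by
    by_contra! hcon
    have : ∑ s', G.p path.length s a b s' ≤ 0 := Finset.sum_nonpos fun s' _ => hcon s'
    rw [hmem.2] at this
    linarith
  have := hG.hist_xinfo (Path.next path s a b s' hp (by rwa [hlen]) hs')
  exact ⟨G.xinfo s', by simpa [obs, hl] using this⟩

/-- The probability that `μ` assigns to the actions on the history of `x`. -/
noncomputable def histProb (G : IIG S X Y A B) (μ : ∀ x, A x → ℝ) (x : X) : ℝ :=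
  ((G.hist x).map fun w => μ w.1 w.2).prod

theorem plan_eq (μ : ∀ x, A x → ℝ) (z : Σ x, A x) :
    G.plan μ z = G.histProb μ z.1 * μ z.1 z.2 := rfl

theorem histProb_of_hist_eq_nil (μ : ∀ x, A x → ℝ) {x : X} (h : G.hist x = []) :
    G.histProb μ x = 1 := by
  simp [histProb, h]

theorem histProb_of_hist_eq_cons (μ : ∀ x, A x → ℝ) {x : X} {z : Σ x, A x}
    (h : G.hist x = z :: G.hist z.1) : G.histProb μ x = G.plan μ z := by
  rw [histProb, h, List.map_cons, List.prod_cons, mul_comm, plan]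

section

variable [∀ x, Fintype (A x)]

theorem histProb_nonneg {μ : ∀ x, A x → ℝ} (hμ : μ ∈ Policies A) (x : X) :
    0 ≤ G.histProb μ x := by
  refine List.prod_nonneg fun a ha => ?_
  obtain ⟨w, -, rfl⟩ := List.mem_map.1 ha
  exact (hμ w.1).1 w.2

theorem plan_nonneg {μ : ∀ x, A x → ℝ} (hμ : μ ∈ Policies A) (z : Σ x, A x) :
    0 ≤ G.plan μ z :=
  mul_nonneg (histProb_nonneg hμ _) ((hμ z.1).1 z.2)

theorem sum_plan_mk {μ : ∀ x, A x → ℝ} (hμ : μ ∈ Policies A) (x : X) :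
    ∑ a, G.plan μ ⟨x, a⟩ = G.histProb μ x := by
  simp only [plan_eq]
  rw [← Finset.mul_sum, (hμ x).2, mul_one]

/-- The realization plans form a convex set. -/
theorem PerfectRecall.exists_plan_eq_combination (hG : G.PerfectRecall) {μ₁ μ₂ : ∀ x, A x → ℝ}
    (h₁ : μ₁ ∈ Policies A) (h₂ : μ₂ ∈ Policies A) {t : ℝ} (ht0 : 0 < t) (ht1 : t < 1) :
    ∃ μ ∈ Policies A, ∀ z, G.plan μ z = (1 - t) * G.plan μ₁ z + t * G.plan μ₂ z := by
  classical
  set ρ : X → ℝ := fun x => (1 - t) * G.histProb μ₁ x + t * G.histProb μ₂ x with hρ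
  have hs : 0 < 1 - t := by linarith
  have hρ0 : ∀ x, 0 ≤ ρ x := fun x =>
    add_nonneg (mul_nonneg hs.le (histProb_nonneg h₁ x)) (mul_nonneg ht0.le (histProb_nonneg h₂ x))
  -- Normalising the mixed plan by the mixed reach probability gives the policy. Where that
  -- probability vanishes both plans contribute zero, and any distribution serves.
  set μ : ∀ x, A x → ℝ := fun x a => if ρ x = 0 then μ₁ x a else
    ((1 - t) * G.plan μ₁ ⟨x, a⟩ + t * G.plan μ₂ ⟨x, a⟩) / ρ x with hμ
  have key : ∀ z, ρ z.1 * μ z.1 z.2 = (1 - t) * G.plan μ₁ z + t * G.plan μ₂ z := by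
    rintro ⟨x, a⟩
    by_cases h0 : ρ x = 0
    · have e := h0
      simp only [hρ] at e
      have e1 := mul_nonneg hs.le (histProb_nonneg (G := G) h₁ x)
      have e2 := mul_nonneg ht0.le (histProb_nonneg (G := G) h₂ x)
      have f1 : (1 - t) * G.histProb μ₁ x = 0 := by linarith
      have f2 : t * G.histProb μ₂ x = 0 := by linarith
      simp only [h0, zero_mul, plan_eq, ← mul_assoc, f1, f2, add_zero]
    · simp only [hμ, h0, if_false]
      field_simp
  have hμp : μ ∈ Policies A := by
    intro x
    by_cases h0 : ρ x = 0
    · have : μ x = μ₁ x := by funext a; simp [hμ, h0]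
      rw [this]; exact h₁ x
    · refine ⟨fun a => ?_, ?_⟩
      · simp only [hμ, h0, if_false]
        exact div_nonneg (add_nonneg (mul_nonneg hs.le (plan_nonneg h₁ _))
          (mul_nonneg ht0.le (plan_nonneg h₂ _))) (hρ0 x)
      · simp only [hμ, h0, if_false]
        rw [← Finset.sum_div, Finset.sum_add_distrib, ← Finset.mul_sum, ← Finset.mul_sum,
          sum_plan_mk h₁, sum_plan_mk h₂]
        exact div_self h0
  have hpre : ∀ x, G.histProb μ x = ρ x := by
    intro x
    induction hn : (G.hist x).length generalizing x with
    | zero =>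
      have hx := List.eq_nil_of_length_eq_zero hn
      simp [hρ, histProb_of_hist_eq_nil _ hx]
    | succ n ih =>
      obtain ⟨v, l, hl⟩ := List.exists_cons_of_length_eq_add_one hn
      have hv := hG.hist_of_cons hl
      have hl' : G.hist x = v :: G.hist v.1 := by rw [hv, hl]
      rw [histProb_of_hist_eq_cons _ hl', plan_eq, ih v.1 (by rw [hv]; simpa [hl] using hn), key]
      simp only [hρ, histProb_of_hist_eq_cons _ hl']
  exact ⟨μ, hμp, fun z => by rw [plan_eq, hpre, key]⟩

end

end History

end IIG

/-! ### Balanced transitions -/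

namespace IIG

theorem policies_nonempty {X : Type*} {A : X → Type*} [∀ x, Fintype (A x)] [∀ x, Nonempty (A x)] :
    (Policies A).Nonempty := by
  classical exact ⟨fun x => Pi.single (Classical.arbitrary (A x)) 1, fun x => single_mem_stdSimplex ℝ _⟩

section Balanced

open scoped Classical

variable {S X Y : Type*} [Fintype S] {A : X → Type*} {B : Y → Type*} {G : IIG S X Y A B}

theorem nonempty_infoSet (G : IIG S X Y A B) : Nonempty X := by
  by_contra hcon
  have : IsEmpty S := ⟨fun s => hcon ⟨G.xinfo s⟩⟩
  simpa using G.p0_mem.2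

variable [Fintype X]

theorem mem_children {z : Σ x, A x} {x : X} :
    x ∈ G.children z ↔ G.hist x = z :: G.hist z.1 := by
  simp [children]

variable [∀ x, Fintype (A x)]

theorem PerfectRecall.sum_depth_succ (hG : G.PerfectRecall) (h : ℕ) (g : X → ℝ) :
    ∑ x with G.depth x = h + 1, g x =
      ∑ z : (Σ x, A x) with G.depth z.1 = h, ∑ x ∈ G.children z, g x := by
  rw [← Finset.sum_biUnion]
  · refine Finset.sum_congr ?_ fun _ _ => rfl
    ext x
    simp only [Finset.mem_filter, Finset.mem_univ, true_and, Finset.mem_biUnion, mem_children]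
    constructor
    · intro hx
      obtain ⟨v, l, hl⟩ := List.exists_cons_of_length_eq_add_one hx
      have hv := hG.hist_of_cons hl
      refine ⟨v, ?_, by rw [hl, hv]⟩
      rw [depth, hl] at hx
      rw [depth, hv]
      simpa using hx
    · rintro ⟨z, rfl, hz⟩
      simp [depth, hz]
  · intro z _ z' _ hne
    simp only [Function.onFun, Finset.disjoint_left, mem_children]
    intro x hx hx'
    rw [hx] at hx'
    exact hne (List.cons.inj hx').1

theorem sum_depth_sigma (h : ℕ) (g : (Σ x, A x) → ℝ) :
    ∑ z : (Σ x, A x) with G.depth z.1 = h, g z =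
      ∑ x with G.depth x = h, ∑ a, g ⟨x, a⟩ := by
  rw [Finset.sum_sigma']
  refine Finset.sum_congr ?_ fun _ _ => rfl
  ext z
  simp

theorem PerfectRecall.sum_eq_sum_depth (hG : G.PerfectRecall) (g : (Σ x, A x) → ℝ) :
    ∑ z, g z = ∑ h ∈ Finset.range G.H, ∑ z : (Σ x, A x) with G.depth z.1 = h, g z := by
  rw [Finset.sum_fiberwise_of_maps_to]
  intro z _
  exact Finset.mem_range.2 (hG.depth_lt z.1)

theorem atau_eq (x : X) :
    G.Atau x = ∑ x' : X with G.Anc x x', (Fintype.card (A x') : ℝ) :=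
  Finset.sum_congr (by ext; rw [Finset.mem_filter, Finset.mem_filter]; rfl) fun _ _ => rfl

theorem atau_pos [∀ x, Nonempty (A x)] (x : X) : 0 < G.Atau x := by
  have h1 : (Fintype.card (A x) : ℝ) ≤ G.Atau x := by
    rw [atau_eq]
    refine Finset.single_le_sum (f := fun x' => (Fintype.card (A x') : ℝ))
      (fun _ _ => Nat.cast_nonneg _) ?_
    simp
    exact Or.inl rfl
  exact lt_of_lt_of_le (Nat.cast_pos.2 Fintype.card_pos) h1

theorem AX_eq : (G.AX : ℝ) = ∑ x, (Fintype.card (A x) : ℝ) := by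
  simp [AX, Fintype.card_sigma]

/-- After exchanging the sums, each information set is counted once, through its unique ancestor of
depth zero. -/
theorem PerfectRecall.sum_root_atau (hG : G.PerfectRecall) :
    ∑ x with G.depth x = 0, G.Atau x = G.AX := by
  simp only [atau_eq, Finset.sum_filter (p := G.Anc _), AX_eq]
  rw [Finset.sum_comm]
  refine Finset.sum_congr rfl fun x' _ => ?_
  obtain ⟨c, hc, hanc⟩ := hG.exists_root_anc x'
  rw [Finset.sum_eq_single c, if_pos hanc]
  · intro b hb hne
    refine if_neg fun h => hne (hG.anc_unique ?_ h hanc)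
    rw [hc]
    simpa using hb
  · intro h
    simp [hc] at h

/-- The subtrees of the children are pairwise disjoint because ancestors of a given depth are
unique, and they miss `x` because they lie strictly deeper. -/
theorem PerfectRecall.card_add_sum_atau_le (hG : G.PerfectRecall) (x : X) :
    Fintype.card (A x) + ∑ a, ∑ c ∈ G.children ⟨x, a⟩, G.Atau c ≤ G.Atau x := by
  have e1 : ∑ a, ∑ c ∈ G.children ⟨x, a⟩, G.Atau c =
      ∑ c ∈ Finset.univ.biUnion fun a => G.children ⟨x, a⟩, G.Atau c := by
    rw [Finset.sum_biUnion]
    intro a _ a' _ hne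
    simp only [Function.onFun, Finset.disjoint_left, mem_children]
    intro c hc hc'
    rw [hc] at hc'
    have := (List.cons.inj hc').1
    simp only [Sigma.mk.injEq, heq_eq_eq, true_and] at this
    exact hne this
  have hch : ∀ c ∈ Finset.univ.biUnion fun a => G.children ⟨x, a⟩,
      ∃ a, G.hist c = ⟨x, a⟩ :: G.hist x := by
    intro c hc
    simpa [mem_children] using hc
  have hdep : ∀ c ∈ Finset.univ.biUnion fun a => G.children ⟨x, a⟩,
      G.depth c = G.depth x + 1 := by
    intro c hc
    obtain ⟨a, ha⟩ := hch c hc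
    simp [depth, ha]
  rw [e1]
  simp only [atau_eq]
  rw [← Finset.sum_biUnion]
  · have hx : x ∉ (Finset.univ.biUnion fun a => G.children ⟨x, a⟩).biUnion
        fun c => Finset.univ.filter fun x' => G.Anc c x' := by
      simp only [Finset.mem_biUnion (s := Finset.univ.biUnion _), Finset.mem_filter,
        Finset.mem_univ, true_and, not_exists, not_and]
      intro c hc hanc
      have := (hG.suffix_of_anc hanc).length_le
      have h2 := hdep c hc
      simp only [depth] at h2
      omega
    rw [← Finset.sum_insert (f := fun x' => (Fintype.card (A x') : ℝ)) hx]
    refine Finset.sum_le_sum_of_subset_of_nonneg ?_ fun _ _ _ => Nat.cast_nonneg _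
    intro x' hx'
    simp only [Finset.mem_filter, Finset.mem_univ, true_and]
    rcases Finset.mem_insert.1 hx' with rfl | hx'
    · exact Or.inl rfl
    · obtain ⟨c, hc, hanc⟩ := Finset.mem_biUnion.1 hx'
      simp only [Finset.mem_filter, Finset.mem_univ, true_and] at hanc
      obtain ⟨a, ha⟩ := hch c hc
      exact Or.inr ⟨a, (hG.suffix_of_anc hanc).subset (by simp [ha])⟩
  · intro c hc c' hc' hne
    simp only [Function.onFun, Finset.disjoint_left, Finset.mem_filter, Finset.mem_univ, true_and]
    intro x' h h'
    exact hne (hG.anc_unique ((hdep c hc).trans (hdep c' hc').symm) h h')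

theorem AX_pos [∀ x, Nonempty (A x)] [Nonempty X] : 0 < G.AX := by
  have : Nonempty (Σ x, A x) := nonempty_sigma.2 ⟨Classical.arbitrary X, inferInstance⟩
  exact Fintype.card_pos

theorem pstar_of_hist_eq_nil {x : X} (h : G.hist x = []) : G.pstar x = G.Atau x / G.AX := by
  rw [pstar, h, balAlong]

theorem pstar_of_hist_eq_cons {x : X} {z : Σ x, A x} (h : G.hist x = z :: G.hist z.1) :
    G.pstar x = G.pstar z.1 * (G.Atau x / ∑ x' ∈ G.children z, G.Atau x') := by
  rw [pstar, h, balAlong, balStep, pstar]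

theorem sum_children_atau_pos [∀ x, Nonempty (A x)] {z : Σ x, A x} {x : X}
    (h : x ∈ G.children z) : 0 < ∑ x' ∈ G.children z, G.Atau x' :=
  Finset.sum_pos (fun c _ => atau_pos c) ⟨x, h⟩

theorem PerfectRecall.pstar_pos [∀ x, Nonempty (A x)] (hG : G.PerfectRecall) (x : X) :
    0 < G.pstar x := by
  have : Nonempty X := ⟨x⟩
  induction hn : (G.hist x).length generalizing x with
  | zero =>
    rw [pstar_of_hist_eq_nil (List.eq_nil_of_length_eq_zero hn)]
    exact div_pos (atau_pos x) (Nat.cast_pos.2 AX_pos)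
  | succ n ih =>
    obtain ⟨v, l, hl⟩ := List.exists_cons_of_length_eq_add_one hn
    have hv := hG.hist_of_cons hl
    have hl' : G.hist x = v :: G.hist v.1 := by rw [hv, hl]
    rw [pstar_of_hist_eq_cons hl']
    exact mul_pos (ih v.1 (by rw [hv]; simpa [hl] using hn))
      (div_pos (atau_pos x) (sum_children_atau_pos (mem_children.2 hl')))

/-- A flow dominated by a unit mass along the tree has total density at most `A_X` with respect
to the balanced transitions. -/
theorem PerfectRecall.sum_div_pstar_le [∀ x, Nonempty (A x)] (hG : G.PerfectRecall)
    {f : X → ℝ} (hf : ∀ x, 0 ≤ f x) (hroot : ∑ x with G.depth x = 0, f x ≤ 1)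
    (hstep : ∀ z : Σ x, A x, ∑ x ∈ G.children z, f x ≤ f z.1) :
    ∑ z : (Σ x, A x), f z.1 / G.pstar z.1 ≤ G.AX := by
  have : Nonempty X := G.nonempty_infoSet
  have hA : (0 : ℝ) < G.AX := Nat.cast_pos.2 AX_pos
  have hd : ∀ x, 0 ≤ f x / G.pstar x := fun x => div_nonneg (hf x) (hG.pstar_pos x).le
  -- Budget invariant: the first sum is reserved for the subtrees rooted at depth `n`, the second is
  -- what shallower layers have spent. The ratio `Atau c / pstar c` is the same for all children of
  -- a pair, so the flow inequality passes the reserve down without increasing it.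
  have hΦ : ∀ n, ∑ x with G.depth x = n, f x / G.pstar x * G.Atau x +
      ∑ h ∈ Finset.range n, ∑ z : (Σ x, A x) with G.depth z.1 = h, f z.1 / G.pstar z.1
        ≤ G.AX := by
    intro n
    induction n with
    | zero =>
      have : ∑ x with G.depth x = 0, f x / G.pstar x * G.Atau x =
          ∑ x with G.depth x = 0, f x * G.AX := by
        refine Finset.sum_congr rfl fun x hx => ?_
        have hx0 : G.depth x = 0 := by simpa using hx
        rw [pstar_of_hist_eq_nil (List.eq_nil_of_length_eq_zero hx0)]
        have := atau_pos (G := G) x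
        field_simp
      rw [this, ← Finset.sum_mul, Finset.range_zero, Finset.sum_empty, add_zero]
      nlinarith
    | succ n ih =>
      refine le_trans ?_ ih
      rw [Finset.sum_range_succ, ← add_assoc, add_right_comm]
      refine add_le_add_left ?_ _
      have h1 : ∑ x with G.depth x = n + 1, f x / G.pstar x * G.Atau x ≤
          ∑ x with G.depth x = n, f x / G.pstar x *
            ∑ a, ∑ c ∈ G.children ⟨x, a⟩, G.Atau c := by
        rw [hG.sum_depth_succ, sum_depth_sigma]
        refine Finset.sum_le_sum fun x _ => ?_
        rw [Finset.mul_sum]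
        refine Finset.sum_le_sum fun a _ => ?_
        set C := ∑ c ∈ G.children ⟨x, a⟩, G.Atau c with hC
        have hC0 : 0 ≤ C := Finset.sum_nonneg fun c _ => (atau_pos c).le
        have : ∑ c ∈ G.children ⟨x, a⟩, f c / G.pstar c * G.Atau c =
            ∑ c ∈ G.children ⟨x, a⟩, f c * (C / G.pstar x) := by
          refine Finset.sum_congr rfl fun c hc => ?_
          rw [pstar_of_hist_eq_cons (mem_children.1 hc)]
          have h1 := sum_children_atau_pos hc
          have h2 := hG.pstar_pos x
          have h3 := atau_pos (G := G) c
          rw [← hC] at h1 ⊢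
          field_simp
        rw [this, ← Finset.sum_mul]
        calc _ ≤ f x * (C / G.pstar x) := mul_le_mul_of_nonneg_right (hstep ⟨x, a⟩)
              (div_nonneg hC0 (hG.pstar_pos x).le)
          _ = _ := by ring
      rw [sum_depth_sigma]
      refine (add_le_add_left h1 _).trans ?_
      rw [← Finset.sum_add_distrib]
      refine Finset.sum_le_sum fun x _ => ?_
      simp only [Finset.sum_const, Finset.card_univ, nsmul_eq_mul]
      have := mul_le_mul_of_nonneg_left (hG.card_add_sum_atau_le x) (hd x)
      linarith
  rw [hG.sum_eq_sum_depth]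
  have := hΦ G.H
  have h0 : 0 ≤ ∑ x with G.depth x = G.H, f x / G.pstar x * G.Atau x :=
    Finset.sum_nonneg fun x _ => mul_nonneg (hd x) (atau_pos x).le
  linarith

/-- These weights are the law of the pair seen at depth `h` when `μ` plays against a nature that
follows the balanced transitions. Every pair before the last step has a child, so the whole mass is
passed on. -/
theorem PerfectRecall.sum_depth_pstar_mul_plan [∀ x, Nonempty (A x)] [∀ y, Nonempty (B y)]
    (hG : G.PerfectRecall) {μ : ∀ x, A x → ℝ} (hμ : μ ∈ Policies A) {h : ℕ} (hh : h < G.H) :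
    ∑ z : (Σ x, A x) with G.depth z.1 = h, G.pstar z.1 * G.plan μ z = 1 := by
  have : Nonempty X := G.nonempty_infoSet
  have hA : (0 : ℝ) < G.AX := Nat.cast_pos.2 AX_pos
  have e : ∀ n, ∑ z : (Σ x, A x) with G.depth z.1 = n, G.pstar z.1 * G.plan μ z =
      ∑ x with G.depth x = n, G.pstar x * G.histProb μ x := by
    intro n
    rw [sum_depth_sigma]
    refine Finset.sum_congr rfl fun x _ => ?_
    rw [← sum_plan_mk hμ, Finset.mul_sum]
  induction h with
  | zero =>
    rw [e]
    have : ∑ x with G.depth x = 0, G.pstar x * G.histProb μ x =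
        ∑ x with G.depth x = 0, G.Atau x / G.AX := by
      refine Finset.sum_congr rfl fun x hx => ?_
      have hx0 : G.hist x = [] := List.eq_nil_of_length_eq_zero (Finset.mem_filter.1 hx).2
      rw [pstar_of_hist_eq_nil hx0, histProb_of_hist_eq_nil _ hx0, mul_one]
    rw [this, ← Finset.sum_div, hG.sum_root_atau, div_self hA.ne']
  | succ n ih =>
    rw [e, ← ih (by omega), hG.sum_depth_succ]
    refine Finset.sum_congr rfl fun z hz => ?_
    have hz' : G.depth z.1 = n := by simpa using hz
    obtain ⟨c, hc⟩ := hG.exists_child z (by omega)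
    have hC := sum_children_atau_pos (mem_children.2 hc)
    have : ∑ x ∈ G.children z, G.pstar x * G.histProb μ x =
        ∑ x ∈ G.children z, G.Atau x *
          (G.pstar z.1 * G.plan μ z / ∑ x' ∈ G.children z, G.Atau x') := by
      refine Finset.sum_congr rfl fun x hx => ?_
      rw [pstar_of_hist_eq_cons (mem_children.1 hx), histProb_of_hist_eq_cons _ (mem_children.1 hx)]
      ring
    rw [this, ← Finset.sum_mul, mul_div_cancel₀ _ hC.ne']

theorem PerfectRecall.sum_pstar_mul_plan [∀ x, Nonempty (A x)] [∀ y, Nonempty (B y)]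
    (hG : G.PerfectRecall) {μ : ∀ x, A x → ℝ} (hμ : μ ∈ Policies A) :
    ∑ z, G.pstar z.1 * G.plan μ z = G.H := by
  rw [hG.sum_eq_sum_depth, Finset.sum_congr rfl fun h hh =>
    hG.sum_depth_pstar_mul_plan hμ (Finset.mem_range.1 hh)]
  simp

theorem PerfectRecall.pstar_mul_plan_nonneg [∀ x, Nonempty (A x)]
    (hG : G.PerfectRecall) {μ : ∀ x, A x → ℝ} (hμ : μ ∈ Policies A) (z : Σ x, A x) :
    0 ≤ G.pstar z.1 * G.plan μ z :=
  mul_nonneg (hG.pstar_pos z.1).le (plan_nonneg hμ z)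

theorem PerfectRecall.pstar_mul_plan_le_one [∀ x, Nonempty (A x)] [∀ y, Nonempty (B y)]
    (hG : G.PerfectRecall) {μ : ∀ x, A x → ℝ} (hμ : μ ∈ Policies A) (z : Σ x, A x) :
    G.pstar z.1 * G.plan μ z ≤ 1 := by
  rw [← hG.sum_depth_pstar_mul_plan hμ (hG.depth_lt z.1)]
  exact Finset.single_le_sum (f := fun z => G.pstar z.1 * G.plan μ z)
    (fun z _ => hG.pstar_mul_plan_nonneg hμ z) (by simp)

/-- There are A_X balanced weights, each at most one, with total `H`. -/
theorem PerfectRecall.H_le_AX [∀ x, Nonempty (A x)] [∀ y, Nonempty (B y)]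
    (hG : G.PerfectRecall) : G.H ≤ G.AX := by
  obtain ⟨μ, hμ⟩ := policies_nonempty (A := A)
  have h : (G.H : ℝ) ≤ G.AX := by
    rw [← hG.sum_pstar_mul_plan hμ]
    refine (Finset.sum_le_sum fun z _ => hG.pstar_mul_plan_le_one hμ z).trans ?_
    simp [AX]
  exact_mod_cast h

end Balanced

end IIG

/-! ### Marginals of a run and occupancy weights -/

theorem prod_fin_eq_mul_prod_pred {M : Type*} [CommMonoid M] {N : ℕ} (hN : 0 < N)
    (g : Fin N → M) :
    ∏ i, g i = g ⟨0, hN⟩ * ∏ i : Fin (N - 1), g ⟨i + 1, by omega⟩ := by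
  obtain ⟨n, rfl⟩ : ∃ n, N = n + 1 := ⟨N - 1, by omega⟩
  exact Fin.prod_univ_succ g

/-- Marginals of a weighted chain whose transition weights are normalised. -/
theorem sum_chain_succ {C : Type*} [Fintype C] (k₀ : C → ℝ) (k : ℕ → C → C → ℝ)
    (M : ℕ → C → ℝ) (hM0 : M 0 = k₀) (n : ℕ)
    (hM : ∀ h < n, ∀ c', M (h + 1) c' = ∑ c, M h c * k h c c')
    (hk : ∀ h < n, ∀ c, ∑ c', k h c c' = 1) (h : Fin (n + 1)) (φ : C → ℝ) :
    ∑ τ : Fin (n + 1) → C,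
      (k₀ (τ 0) * ∏ i : Fin n, k i (τ i.castSucc) (τ i.succ)) * φ (τ h) = ∑ c, M h c * φ c := by
  induction n generalizing φ with
  | zero =>
    obtain rfl : h = 0 := Subsingleton.elim (α := Fin 1) _ _
    rw [← (Equiv.funUnique (Fin 1) C).symm.sum_comp]
    simp [hM0]
  | succ n ih =>
    rw [← (Fin.snocEquiv fun _ => C).sum_comp, Fintype.sum_prod_type_right]
    have hW : ∀ (τ : Fin (n + 1) → C) (c : C),
        k₀ ((Fin.snocEquiv fun _ => C) (c, τ) 0) * ∏ i : Fin (n + 1),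
          k i ((Fin.snocEquiv fun _ => C) (c, τ) i.castSucc)
            ((Fin.snocEquiv fun _ => C) (c, τ) i.succ) =
        (k₀ (τ 0) * ∏ i : Fin n, k i (τ i.castSucc) (τ i.succ)) * k n (τ (Fin.last n)) c := by
      intro τ c
      have h0 : (0 : Fin (n + 2)) = (0 : Fin (n + 1)).castSucc := rfl
      rw [Fin.prod_univ_castSucc, ← mul_assoc]
      simp only [Fin.snocEquiv, Equiv.coe_fn_mk, Fin.succ_last, Fin.snoc_last, h0,
        Fin.snoc_castSucc, Fin.val_castSucc, Fin.val_last, ← Fin.castSucc_succ]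
    simp only [hW]
    induction h using Fin.lastCases with
    | last =>
      have hs : ∀ τ : Fin (n + 1) → C, ∀ c,
          (Fin.snocEquiv fun _ => C) (c, τ) (Fin.last (n + 1)) = c := fun τ c => by
        simp [Fin.snocEquiv]
      simp only [hs, mul_assoc, ← Finset.mul_sum]
      simp only [← mul_assoc]
      -- For the final coordinate the last kernel is absorbed into the test function; for an earlier
      -- coordinate, the other case, it simply sums to one.
      rw [ih (fun h hh => hM h (by omega)) (fun h hh => hk h (by omega)) (Fin.last n)
        fun d => ∑ c, k n d c * φ c]
      simp only [Fin.val_last, hM n (by omega), Finset.mul_sum, Finset.sum_mul]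
      rw [Finset.sum_comm]
      simp only [mul_assoc]
    | cast h =>
      have hs : ∀ τ : Fin (n + 1) → C, ∀ c,
          (Fin.snocEquiv fun _ => C) (c, τ) h.castSucc = τ h := fun τ c => by
        simp [Fin.snocEquiv]
      simp only [hs, Fin.val_castSucc]
      rw [← ih (fun h hh => hM h (by omega)) (fun h hh => hk h (by omega)) h φ]
      refine Finset.sum_congr rfl fun τ _ => ?_
      rw [← Finset.sum_mul, ← Finset.mul_sum, hk n (by omega), mul_one]

theorem sum_chain {C : Type*} [Fintype C] (k₀ : C → ℝ) (k : ℕ → C → C → ℝ)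
    (M : ℕ → C → ℝ) (hM0 : M 0 = k₀) {N : ℕ} (hN : 0 < N)
    (hM : ∀ h, h + 1 < N → ∀ c', M (h + 1) c' = ∑ c, M h c * k h c c')
    (hk : ∀ h, h + 1 < N → ∀ c, ∑ c', k h c c' = 1) (h : Fin N) (φ : C → ℝ) :
    ∑ τ : Fin N → C, (k₀ (τ ⟨0, hN⟩) * ∏ i : Fin (N - 1),
      k i (τ ⟨i, by omega⟩) (τ ⟨i + 1, by omega⟩)) * φ (τ h) = ∑ c, M h c * φ c := by
  obtain ⟨n, rfl⟩ : ∃ n, N = n + 1 := ⟨N - 1, by omega⟩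
  exact sum_chain_succ k₀ k M hM0 n (fun h hh => hM h (by omega)) (fun h hh => hk h (by omega)) h φ

namespace IIG

section Occupancy

variable {S X Y : Type*} [Fintype S] {A : X → Type*} {B : Y → Type*}
  [∀ x, Fintype (A x)] [∀ y, Fintype (B y)] {G : IIG S X Y A B}

/-- Weight of reaching a state at step `n`, with the probabilities of the actions of the
max-player left out. -/
noncomputable def occ (G : IIG S X Y A B) (ν : ∀ y, B y → ℝ) : ℕ → S → ℝ
  | 0, s => G.p0 s
  | n + 1, s' => ∑ c : G.Step,
      occ G ν n c.1 * ν (G.yinfo c.1) c.2.2 * G.p n c.1 c.2.1 c.2.2 s'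

theorem sum_step (g : S → ℝ) (μ : ∀ x, A x → ℝ) (ν : ∀ y, B y → ℝ)
    (hμ : μ ∈ Policies A) (hν : ν ∈ Policies B) :
    ∑ c : G.Step, g c.1 * (μ (G.xinfo c.1) c.2.1 * ν (G.yinfo c.1) c.2.2) = ∑ s, g s := by
  rw [Fintype.sum_sigma]
  refine Finset.sum_congr rfl fun s _ => ?_
  rw [Fintype.sum_prod_type]
  simp only [← Finset.mul_sum]
  simp only [(hν (G.yinfo s)).2, mul_one, (hμ (G.xinfo s)).2]

theorem occ_nonneg {ν : ∀ y, B y → ℝ} (hν : ν ∈ Policies B) :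
    ∀ {n : ℕ}, n < G.H → ∀ s, 0 ≤ G.occ ν n s
  | 0, _, s => G.p0_mem.1 s
  | n + 1, hn, s => Finset.sum_nonneg fun c _ =>
      mul_nonneg (mul_nonneg (occ_nonneg hν (by omega) c.1) ((hν _).1 _))
        ((G.p_mem n hn c.1 c.2.1 c.2.2).1 s)

/-- Perfect recall speaks only of paths of positive probability. This supplies such a path wherever
the weight does not vanish, so all other states can be dropped from the sums. -/
theorem exists_path_of_occ_ne_zero {ν : ∀ y, B y → ℝ} :
    ∀ {n : ℕ}, n < G.H → ∀ {s}, G.occ ν n s ≠ 0 → ∃ l, l.length = n ∧ G.Path l s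
  | 0, _, s, hs => ⟨[], rfl, Path.root s (lt_of_le_of_ne (G.p0_mem.1 s) (Ne.symm hs))⟩
  | n + 1, hn, s, hs => by
      obtain ⟨⟨s₀, a, b⟩, -, hc⟩ := Finset.exists_ne_zero_of_sum_ne_zero hs
      obtain ⟨l, rfl, hl⟩ := exists_path_of_occ_ne_zero (by omega)
        (left_ne_zero_of_mul (left_ne_zero_of_mul hc))
      exact ⟨⟨s₀, a, b⟩ :: l, by simp, Path.next l s₀ a b s hl hn
        (lt_of_le_of_ne ((G.p_mem _ hn _ _ _).1 s) (Ne.symm (right_ne_zero_of_mul hc)))⟩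

theorem PerfectRecall.depth_of_occ_ne_zero (hG : G.PerfectRecall) {ν : ∀ y, B y → ℝ} {n : ℕ}
    (hn : n < G.H) {s : S} (hs : G.occ ν n s ≠ 0) : G.depth (G.xinfo s) = n := by
  obtain ⟨l, hl, hp⟩ := exists_path_of_occ_ne_zero hn hs
  rw [depth, hG.hist_xinfo hp, List.length_map, hl]

theorem PerfectRecall.hist_of_transition (hG : G.PerfectRecall) {ν : ∀ y, B y → ℝ} {n : ℕ}
    (hn : n + 1 < G.H) {c : G.Step} {s' : S} (hs : G.occ ν n c.1 ≠ 0)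
    (hp : G.p n c.1 c.2.1 c.2.2 s' ≠ 0) :
    G.hist (G.xinfo s') = G.obs c :: G.hist (G.xinfo c.1) := by
  obtain ⟨l, rfl, hl⟩ := exists_path_of_occ_ne_zero (by omega) hs
  have := Path.next l c.1 c.2.1 c.2.2 s' hl hn
    (lt_of_le_of_ne ((G.p_mem _ hn _ _ _).1 s') (Ne.symm hp))
  rw [hG.hist_xinfo this, hG.hist_xinfo hl]
  rfl

theorem trajProb_eq (μ : ∀ x, A x → ℝ) (ν : ∀ y, B y → ℝ) (τ : G.Traj) :
    G.trajProb μ ν τ = (G.p0 (τ ⟨0, G.H_pos⟩).1 *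
      (μ (G.xinfo (τ ⟨0, G.H_pos⟩).1) (τ ⟨0, G.H_pos⟩).2.1 *
        ν (G.yinfo (τ ⟨0, G.H_pos⟩).1) (τ ⟨0, G.H_pos⟩).2.2)) *
      ∏ h : Fin (G.H - 1),
        (G.p h (τ ⟨h, by omega⟩).1 (τ ⟨h, by omega⟩).2.1 (τ ⟨h, by omega⟩).2.2
          (τ ⟨h + 1, by omega⟩).1 *
        (μ (G.xinfo (τ ⟨h + 1, by omega⟩).1) (τ ⟨h + 1, by omega⟩).2.1 *
          ν (G.yinfo (τ ⟨h + 1, by omega⟩).1) (τ ⟨h + 1, by omega⟩).2.2)) := by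
  rw [trajProb, prod_fin_eq_mul_prod_pred G.H_pos]
  simp only [Finset.prod_mul_distrib]
  ring

/-- A run is a Markov chain on steps whose kernel draws a state and then both actions. All paths to
a given information set carry the same max-player history, so the max-player's factors collapse to
`plan` and leave the marginal in product form. -/
theorem PerfectRecall.sum_trajProb_mul (hG : G.PerfectRecall) {μ : ∀ x, A x → ℝ}
    {ν : ∀ y, B y → ℝ} (hμ : μ ∈ Policies A) (hν : ν ∈ Policies B) (h : Fin G.H)
    (φ : G.Step → ℝ) :
    ∑ τ : G.Traj, G.trajProb μ ν τ * φ (τ h) =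
      ∑ c : G.Step, G.plan μ (G.obs c) * G.occ ν h c.1 * ν (G.yinfo c.1) c.2.2 * φ c := by
  simp only [trajProb_eq]
  refine sum_chain
    (fun c : G.Step => G.p0 c.1 * (μ (G.xinfo c.1) c.2.1 * ν (G.yinfo c.1) c.2.2))
    (fun h c c' => G.p h c.1 c.2.1 c.2.2 c'.1 *
      (μ (G.xinfo c'.1) c'.2.1 * ν (G.yinfo c'.1) c'.2.2))
    (fun h c => G.plan μ (G.obs c) * G.occ ν h c.1 * ν (G.yinfo c.1) c.2.2)
    ?_ G.H_pos ?_ ?_ h φ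
  · funext c
    by_cases hc : G.p0 c.1 = 0
    · simp [occ, hc]
    · have h1 := hG.depth_of_occ_ne_zero (ν := ν) (n := 0) G.H_pos hc
      rw [plan_eq, histProb_of_hist_eq_nil (x := (G.obs c).1) _ (List.eq_nil_of_length_eq_zero h1)]
      simp only [obs, occ]
      ring
  · intro h hh c'
    simp only [occ, Finset.mul_sum, Finset.sum_mul]
    refine Finset.sum_congr rfl fun c _ => ?_
    -- Only transitions of positive weight matter; for these the history of the new information set
    -- is the old one extended by `obs c`.
    by_cases h1 : G.occ ν h c.1 = 0
    · simp [h1]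
    by_cases h2 : G.p h c.1 c.2.1 c.2.2 c'.1 = 0
    · simp [h2]
    have := hG.hist_of_transition hh h1 h2
    rw [plan_eq μ (G.obs c'), histProb_of_hist_eq_cons (x := (G.obs c').1) (z := G.obs c) μ this]
    simp only [obs]
    ring
  · intro h hh c
    rw [sum_step _ _ _ hμ hν]
    exact (G.p_mem h hh c.1 c.2.1 c.2.2).2

theorem trajProb_nonneg {μ : ∀ x, A x → ℝ}
    {ν : ∀ y, B y → ℝ} (hμ : μ ∈ Policies A) (hν : ν ∈ Policies B) (τ : G.Traj) :
    0 ≤ G.trajProb μ ν τ :=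
  mul_nonneg (mul_nonneg (G.p0_mem.1 _) (Finset.prod_nonneg fun _ _ =>
    mul_nonneg ((hμ _).1 _) ((hν _).1 _))) (Finset.prod_nonneg fun h _ =>
      (G.p_mem h (by omega) _ _ _).1 _)

theorem PerfectRecall.sum_trajProb (hG : G.PerfectRecall) {μ : ∀ x, A x → ℝ}
    {ν : ∀ y, B y → ℝ} (hμ : μ ∈ Policies A) (hν : ν ∈ Policies B) :
    ∑ τ : G.Traj, G.trajProb μ ν τ = 1 := by
  have h1 := hG.sum_trajProb_mul hμ hν ⟨0, G.H_pos⟩ fun _ => 1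
  simp only [mul_one] at h1
  rw [h1, ← G.p0_mem.2, ← sum_step (G := G) _ _ _ hμ hν]
  refine Finset.sum_congr rfl fun c _ => ?_
  by_cases hc : G.p0 c.1 = 0
  · simp [occ, hc]
  · have h1 := hG.depth_of_occ_ne_zero (ν := ν) (n := 0) G.H_pos hc
    rw [plan_eq, histProb_of_hist_eq_nil (x := (G.obs c).1) _ (List.eq_nil_of_length_eq_zero h1)]
    simp only [obs, occ]
    ring

theorem reward_mem (τ : G.Traj) (h : Fin G.H) : G.reward τ h ∈ Set.Icc (0 : ℝ) 1 :=
  G.r_mem h h.2 _ _ _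

end Occupancy

/-! ### The loss vector and its balanced mass -/

section Loss

open scoped Classical

variable {S X Y : Type*} [Fintype S] [Fintype X] {A : X → Type*} {B : Y → Type*}
  [∀ x, Fintype (A x)] [∀ y, Fintype (B y)] {G : IIG S X Y A B}

/-- The loss vector against `ν`: the expected loss at a pair, with the probabilities of
the actions of the max-player left out. -/
noncomputable def lossVec (G : IIG S X Y A B) (ν : ∀ y, B y → ℝ) (z : Σ x, A x) : ℝ :=
  ∑ c : G.Step with G.obs c = z, G.occ ν (G.depth z.1) c.1 * ν (G.yinfo c.1) c.2.2 *
    (1 - G.r (G.depth z.1) c.1 c.2.1 c.2.2)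

theorem PerfectRecall.lossVec_nonneg (hG : G.PerfectRecall) {ν : ∀ y, B y → ℝ}
    (hν : ν ∈ Policies B) (z : Σ x, A x) : 0 ≤ G.lossVec ν z :=
  Finset.sum_nonneg fun _ _ => mul_nonneg
    (mul_nonneg (occ_nonneg hν (hG.depth_lt z.1) _) ((hν _).1 _))
    (sub_nonneg.2 (G.r_mem _ (hG.depth_lt z.1) _ _ _).2)

theorem PerfectRecall.sum_trajProb_mul_loss (hG : G.PerfectRecall) {μ : ∀ x, A x → ℝ}
    {ν : ∀ y, B y → ℝ} (hμ : μ ∈ Policies A) (hν : ν ∈ Policies B) (h : Fin G.H)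
    (φ : (Σ x, A x) → ℝ) :
    ∑ τ : G.Traj, G.trajProb μ ν τ * (φ (G.obs (τ h)) * (1 - G.reward τ h)) =
      ∑ z : (Σ x, A x) with G.depth z.1 = h, G.plan μ z * G.lossVec ν z * φ z := by
  have := hG.sum_trajProb_mul hμ hν h
    fun c => φ (G.obs c) * (1 - G.r h c.1 c.2.1 c.2.2)
  simp only [reward]
  rw [this, ← Finset.sum_fiberwise (s := Finset.univ) (g := G.obs), Finset.sum_filter]
  refine Finset.sum_congr rfl fun z _ => ?_
  by_cases hz : G.depth z.1 = h
  · rw [if_pos hz, lossVec, Finset.mul_sum, Finset.sum_mul]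
    refine Finset.sum_congr rfl fun c hc => ?_
    obtain rfl : G.obs c = z := by simpa using hc
    rw [hz]
    ring
  · rw [if_neg hz]
    refine Finset.sum_eq_zero fun c hc => ?_
    obtain rfl : G.obs c = z := by simpa using hc
    -- A state can carry weight at step `h` only if its information set has depth `h`.
    have : G.occ ν h c.1 = 0 := by
      by_contra hne
      exact hz (hG.depth_of_occ_ne_zero h.2 hne)
    simp [this]

/-- Losses are one minus rewards, so summing the step marginals over the `H` steps makes the value
affine in the plan. This is the reduction to online linear optimization. -/
theorem PerfectRecall.sum_plan_mul_lossVec (hG : G.PerfectRecall) {μ : ∀ x, A x → ℝ}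
    {ν : ∀ y, B y → ℝ} (hμ : μ ∈ Policies A) (hν : ν ∈ Policies B) :
    ∑ z, G.plan μ z * G.lossVec ν z = G.H - G.value μ ν := by
  have h1 := fun h => hG.sum_trajProb_mul_loss hμ hν h fun _ => 1
  simp only [mul_one, one_mul] at h1
  rw [hG.sum_eq_sum_depth, Finset.sum_range]
  simp only [← h1]
  rw [Finset.sum_comm, value]
  simp only [← Finset.mul_sum, Finset.sum_sub_distrib, mul_sub]
  simp [← Finset.sum_mul, hG.sum_trajProb hμ hν]

theorem value_nonneg {μ : ∀ x, A x → ℝ} {ν : ∀ y, B y → ℝ}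
    (hμ : μ ∈ Policies A) (hν : ν ∈ Policies B) : 0 ≤ G.value μ ν :=
  Finset.sum_nonneg fun τ _ => mul_nonneg (trajProb_nonneg hμ hν τ)
    (Finset.sum_nonneg fun h _ => (reward_mem τ h).1)

theorem PerfectRecall.sum_plan_mul_lossVec_le (hG : G.PerfectRecall) {μ : ∀ x, A x → ℝ}
    {ν : ∀ y, B y → ℝ} (hμ : μ ∈ Policies A) (hν : ν ∈ Policies B) :
    ∑ z, G.plan μ z * G.lossVec ν z ≤ G.H := by
  rw [hG.sum_plan_mul_lossVec hμ hν]
  linarith [value_nonneg (G := G) hμ hν]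

/-- Weight of reaching an information set, with the probabilities of the actions of the
max-player left out. -/
noncomputable def reach (G : IIG S X Y A B) (ν : ∀ y, B y → ℝ) (x : X) : ℝ :=
  ∑ s with G.xinfo s = x, G.occ ν (G.depth x) s

theorem sum_obs_eq {ν : ∀ y, B y → ℝ} (hν : ν ∈ Policies B) (g : S → ℝ) (z : Σ x, A x) :
    ∑ c : G.Step with G.obs c = z, g c.1 * ν (G.yinfo c.1) c.2.2 =
      ∑ s with G.xinfo s = z.1, g s := by
  rw [Finset.sum_filter, Fintype.sum_sigma, Finset.sum_filter]
  refine Finset.sum_congr rfl fun s _ => ?_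
  rw [Fintype.sum_prod_type]
  obtain ⟨x, a⟩ := z
  by_cases hx : G.xinfo s = x
  · subst hx
    rw [if_pos rfl, Finset.sum_eq_single a]
    · simp only [obs, if_true, ← Finset.mul_sum, (hν (G.yinfo s)).2, mul_one]
    · intro a' _ hne
      refine Finset.sum_eq_zero fun b _ => if_neg ?_
      simpa [obs] using hne
    · simp
  · rw [if_neg hx]
    refine Finset.sum_eq_zero fun a' _ => Finset.sum_eq_zero fun b _ => if_neg ?_
    intro h
    exact hx (congrArg Sigma.fst h)

/-- Forgetting the reward replaces the loss by a quantity independent of the action, which satisfies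
the flow conditions required by `PerfectRecall.sum_div_pstar_le`. -/
theorem PerfectRecall.lossVec_le_reach (hG : G.PerfectRecall) {ν : ∀ y, B y → ℝ}
    (hν : ν ∈ Policies B) (z : Σ x, A x) : G.lossVec ν z ≤ G.reach ν z.1 := by
  rw [reach, ← sum_obs_eq hν, lossVec]
  refine Finset.sum_le_sum fun c _ => mul_le_of_le_one_right
    (mul_nonneg (occ_nonneg hν (hG.depth_lt z.1) _) ((hν _).1 _)) ?_
  linarith [(G.r_mem _ (hG.depth_lt z.1) c.1 c.2.1 c.2.2).1]

theorem PerfectRecall.reach_nonneg (hG : G.PerfectRecall) {ν : ∀ y, B y → ℝ}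
    (hν : ν ∈ Policies B) (x : X) : 0 ≤ G.reach ν x :=
  Finset.sum_nonneg fun s _ => occ_nonneg hν (hG.depth_lt x) s

theorem sum_reach_root_le {ν : ∀ y, B y → ℝ} :
    ∑ x with G.depth x = 0, G.reach ν x ≤ 1 := by
  calc ∑ x with G.depth x = 0, G.reach ν x
      = ∑ x with G.depth x = 0, ∑ s with G.xinfo s = x, G.p0 s := by
        refine Finset.sum_congr rfl fun x hx => ?_
        rw [reach, (Finset.mem_filter.1 hx).2]
        rfl
    _ ≤ ∑ x, ∑ s with G.xinfo s = x, G.p0 s :=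
        Finset.sum_le_sum_of_subset_of_nonneg (Finset.filter_subset _ _) fun x _ _ =>
          Finset.sum_nonneg fun s _ => G.p0_mem.1 s
    _ = 1 := by rw [Finset.sum_fiberwise (g := G.xinfo), G.p0_mem.2]

theorem PerfectRecall.sum_reach_children_le (hG : G.PerfectRecall) {ν : ∀ y, B y → ℝ}
    (hν : ν ∈ Policies B) (z : Σ x, A x) :
    ∑ x ∈ G.children z, G.reach ν x ≤ G.reach ν z.1 := by
  set d := G.depth z.1 with hd
  have hdep : ∀ x ∈ G.children z, G.depth x = d + 1 := by
    intro x hx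
    rw [depth, mem_children.1 hx, List.length_cons, hd, depth]
  rcases (G.children z).eq_empty_or_nonempty with he | ⟨x₀, hx₀⟩
  · rw [he, Finset.sum_empty]
    exact hG.reach_nonneg hν _
  have hdH : d + 1 < G.H := by
    rw [← hdep x₀ hx₀]
    exact hG.depth_lt x₀
  have hocc : ∀ c : G.Step, 0 ≤ G.occ ν d c.1 * ν (G.yinfo c.1) c.2.2 := fun c =>
    mul_nonneg (occ_nonneg hν (by omega) _) ((hν _).1 _)
  calc ∑ x ∈ G.children z, G.reach ν x
      = ∑ x ∈ G.children z, ∑ s' with G.xinfo s' = x, ∑ c : G.Step with G.obs c = z,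
          G.occ ν d c.1 * ν (G.yinfo c.1) c.2.2 * G.p d c.1 c.2.1 c.2.2 s' := by
        refine Finset.sum_congr rfl fun x hx => ?_
        rw [reach, hdep x hx]
        refine Finset.sum_congr rfl fun s' hs' => ?_
        rw [occ, Finset.sum_filter]
        refine Finset.sum_congr rfl fun c _ => ?_
        split_ifs with hc
        · rfl
        · by_contra hne
          -- A step that enters a child of `z` with positive weight must be observed as `z`, since
          -- it is the latest entry of the child's history.
          have h1 := hG.hist_of_transition hdH (left_ne_zero_of_mul (left_ne_zero_of_mul hne))
            (right_ne_zero_of_mul hne)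
          rw [(Finset.mem_filter.1 hs').2, mem_children.1 hx] at h1
          exact hc (List.cons.inj h1).1.symm
    _ ≤ ∑ x, ∑ s' with G.xinfo s' = x, ∑ c : G.Step with G.obs c = z,
          G.occ ν d c.1 * ν (G.yinfo c.1) c.2.2 * G.p d c.1 c.2.1 c.2.2 s' :=
        Finset.sum_le_sum_of_subset_of_nonneg (Finset.subset_univ _) fun x _ _ =>
          Finset.sum_nonneg fun s' _ => Finset.sum_nonneg fun c _ =>
            mul_nonneg (hocc c) ((G.p_mem d hdH _ _ _).1 _)
    _ = ∑ c : G.Step with G.obs c = z, G.occ ν d c.1 * ν (G.yinfo c.1) c.2.2 := by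
        rw [Finset.sum_fiberwise (g := G.xinfo), Finset.sum_comm]
        refine Finset.sum_congr rfl fun c _ => ?_
        rw [← Finset.mul_sum, (G.p_mem d hdH _ _ _).2, mul_one]
    _ = G.reach ν z.1 := by rw [sum_obs_eq hν, reach]

theorem PerfectRecall.sum_lossVec_div_pstar_le [∀ x, Nonempty (A x)] (hG : G.PerfectRecall)
    {ν : ∀ y, B y → ℝ} (hν : ν ∈ Policies B) :
    ∑ z, G.lossVec ν z / G.pstar z.1 ≤ G.AX :=
  (Finset.sum_le_sum fun z _ => div_le_div_of_nonneg_right (hG.lossVec_le_reach hν z)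
    (hG.pstar_pos z.1).le).trans
    (hG.sum_div_pstar_le (hG.reach_nonneg hν) sum_reach_root_le (hG.sum_reach_children_le hν))

end Loss

end IIG

/-! ### Potentials with one-sided curvature -/

/-- A convex potential on `[0, ∞)` whose curvature on `[0, v]` is at least `v ^ (q - 2) / κ`. -/
structure IsPotential (ψ : ℝ → ℝ) (q κ : ℝ) : Prop where
  κ_pos : 0 < κ
  convex : ConvexOn ℝ (Set.Ici 0) ψ
  curved : ∀ v, 0 < v →
    ConvexOn ℝ (Set.Icc 0 v) fun x => ψ x - v ^ (q - 2) / κ * (x ^ 2 / 2)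

/-- Lower bound on the Bregman divergence of a potential. -/
noncomputable def divLower (q κ u v : ℝ) : ℝ :=
  if u < v then v ^ (q - 2) / κ * ((v - u) ^ 2 / 2) else 0

/-- When `u < v` the segment lies in `[0, v]`, where the curvature is controlled by its value at
`v`; otherwise plain convexity is used and nothing is gained. -/
theorem IsPotential.apply_combination_le {ψ : ℝ → ℝ} {q κ : ℝ} (h : IsPotential ψ q κ) {u v t : ℝ}
    (hu : 0 ≤ u) (hv : 0 ≤ v) (ht0 : 0 < t) (ht1 : t < 1) :
    ψ ((1 - t) * v + t * u) ≤ (1 - t) * ψ v + t * ψ u - t * (1 - t) * divLower q κ u v := by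
  rw [divLower]
  split_ifs with huv
  · have := (h.curved v (hu.trans_lt huv)).2 (x := v) ⟨hv, le_rfl⟩ (y := u) ⟨hu, huv.le⟩
      (sub_nonneg.2 ht1.le) ht0.le (by ring)
    simp only [smul_eq_mul] at this
    linear_combination this
  · have := h.convex.2 (x := v) hv (y := u) hu (sub_nonneg.2 ht1.le) ht0.le (by ring)
    simp only [smul_eq_mul] at this
    linear_combination this

/-- For `u < v`, complete the square in `v - u`. For `u ≥ v` the linear term is non-positive because
losses are non-negative, which is why one-sided curvature is enough. -/
theorem mul_sub_divLower_le {q κ : ℝ} (hκ : 0 < κ) {η u v l : ℝ} (hη : 0 < η)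
    (hv : 0 ≤ v) (hu : 0 ≤ u) (hl : 0 ≤ l) :
    (v - u) * l - divLower q κ u v / η ≤ η * κ / 2 * (v ^ (2 - q) * l ^ 2) := by
  have hR : 0 ≤ η * κ / 2 * (v ^ (2 - q) * l ^ 2) := by positivity
  rw [divLower]
  split_ifs with huv
  · have hv0 : 0 < v := hu.trans_lt huv
    have e : v ^ (q - 2) = (v ^ (2 - q))⁻¹ := by rw [← Real.rpow_neg hv0.le, neg_sub]
    have hb : 0 < v ^ (2 - q) := Real.rpow_pos_of_pos hv0 _
    rw [e]
    set b := v ^ (2 - q)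
    have : η * κ / 2 * (b * l ^ 2) - ((v - u) * l - b⁻¹ / κ * ((v - u) ^ 2 / 2) / η) =
        ((v - u) - η * κ * b * l) ^ 2 / (2 * η * κ * b) := by
      field_simp
      ring
    have h2 : 0 ≤ ((v - u) - η * κ * b * l) ^ 2 / (2 * η * κ * b) := by positivity
    linarith
  · have : (v - u) * l ≤ 0 := mul_nonpos_of_nonpos_of_nonneg (by linarith) hl
    simpa using this.trans hR

theorem le_of_forall_one_sub_mul_le {D Δ : ℝ}
    (h : ∀ t : ℝ, 0 < t → t < 1 → (1 - t) * D ≤ Δ) : D ≤ Δ := by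
  by_contra! hlt
  have h1 := h (1 / 2) (by norm_num) (by norm_num)
  have hD0 : 0 < D := by nlinarith
  -- This `t` turns `(1 - t) * D` into the midpoint of `D` and `Δ`, which exceeds `Δ`.
  have h2 := h ((D - Δ) / (2 * D)) (div_pos (by linarith) (by linarith))
    (by rw [div_lt_one (by linarith)]; linarith)
  have : (1 - (D - Δ) / (2 * D)) * D = (D + Δ) / 2 := by field_simp; ring
  linarith

/-- The second derivative q(1-q) x^(q-2) is decreasing, so on `(0, v]` it is smallest at `v`; this
gives κ = 1/(q(1-q)). -/
theorem isPotential_tsallis {q : ℝ} (hq0 : 0 < q) (hq1 : q < 1) :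
    IsPotential (fun x => -(x ^ q)) q (1 / (q * (1 - q))) where
  κ_pos := by
    have : 0 < 1 - q := by linarith
    positivity
  convex := (Real.concaveOn_rpow hq0.le hq1.le).neg
  curved v hv := by
    refine convexOn_of_hasDerivWithinAt2_nonneg (convex_Icc 0 v)
      (f' := fun x => -(q * x ^ (q - 1)) - v ^ (q - 2) / (1 / (q * (1 - q))) * x)
      (f'' := fun x => -(q * ((q - 1) * x ^ (q - 2))) - v ^ (q - 2) / (1 / (q * (1 - q)))) ?_ ?_ ?_ ?_
    · have : Continuous fun x : ℝ => x ^ q := Real.continuous_rpow_const hq0.le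
      fun_prop
    · intro x hx
      rw [interior_Icc] at hx
      have h1 := (Real.hasDerivAt_rpow_const (x := x) (p := q) (Or.inl hx.1.ne')).neg
      have h2 := ((hasDerivAt_pow 2 x).div_const 2).const_mul (v ^ (q - 2) / (1 / (q * (1 - q))))
      refine ((h1.sub h2).congr_deriv ?_).hasDerivWithinAt
      norm_num
    · intro x hx
      rw [interior_Icc] at hx
      have h1 := ((Real.hasDerivAt_rpow_const (x := x) (p := q - 1) (Or.inl hx.1.ne')).const_mul q).neg
      have h2 := (hasDerivAt_id x).const_mul (v ^ (q - 2) / (1 / (q * (1 - q))))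
      refine ((h1.sub h2).congr_deriv ?_).hasDerivWithinAt
      rw [mul_one, show q - 1 - 1 = q - 2 by ring]
    · intro x hx
      rw [interior_Icc] at hx
      have h1 : v ^ (q - 2) ≤ x ^ (q - 2) :=
        Real.rpow_le_rpow_of_nonpos hx.1 hx.2.le (by linarith)
      have h2 : 0 < q * (1 - q) := mul_pos hq0 (by linarith)
      rw [div_div_eq_mul_div, div_one]
      nlinarith

theorem isPotential_shannon : IsPotential (fun x => x * Real.log x) 1 1 where
  κ_pos := one_pos
  convex := Real.convexOn_mul_log
  curved v hv := by
    have e : v ^ ((1 : ℝ) - 2) / 1 = v⁻¹ := by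
      rw [show (1 : ℝ) - 2 = -1 by norm_num, Real.rpow_neg_one, div_one]
    rw [e]
    refine convexOn_of_hasDerivWithinAt2_nonneg (convex_Icc 0 v)
      (f' := fun x => Real.log x + 1 - v⁻¹ * x) (f'' := fun x => x⁻¹ - v⁻¹) ?_ ?_ ?_ ?_
    · have := Real.continuous_mul_log
      fun_prop
    · intro x hx
      rw [interior_Icc] at hx
      have h1 := Real.hasDerivAt_mul_log hx.1.ne'
      have h2 := ((hasDerivAt_pow 2 x).div_const 2).const_mul v⁻¹
      refine ((h1.sub h2).congr_deriv ?_).hasDerivWithinAt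
      norm_num
    · intro x hx
      rw [interior_Icc] at hx
      have h1 := (Real.hasDerivAt_log hx.1.ne').add_const 1
      have h2 := (hasDerivAt_id x).const_mul v⁻¹
      refine ((h1.sub h2).congr_deriv ?_).hasDerivWithinAt
      rw [mul_one]
    · intro x hx
      rw [interior_Icc] at hx
      exact sub_nonneg.2 (inv_anti₀ hx.1 hx.2.le)

/-! ### Follow-the-regularized-leader on realization plans -/

namespace IIG

section FTRL

open scoped Classical

variable {S X Y : Type*} [Fintype S] [Fintype X] {A : X → Type*} {B : Y → Type*}
  [∀ x, Fintype (A x)] {G : IIG S X Y A B}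

/-- The total value of the separable regularizer with potential `ψ`. -/
noncomputable def potential (G : IIG S X Y A B) (ψ : ℝ → ℝ) (μ : ∀ x, A x → ℝ) : ℝ :=
  ∑ z, ψ (G.pstar z.1 * G.plan μ z)

theorem PerfectRecall.objective_eq (hG : G.PerfectRecall) {ψ : ℝ → ℝ}
    {Ψ : ℕ → ((Σ x, A x) → ℝ) → ℝ}
    (hΨ : ∀ h w, Ψ h w = ∑ z : (Σ x, A x) with G.depth z.1 = h, ψ (w z))
    (η : ℝ) (L : (Σ x, A x) → ℝ) (μ : ∀ x, A x → ℝ) :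
    G.objective Ψ (fun _ => η) L μ = ∑ z, G.plan μ z * L z + G.potential ψ μ / η := by
  rw [objective, potential, hG.sum_eq_sum_depth fun z => ψ (G.pstar z.1 * G.plan μ z),
    Finset.sum_div]
  simp only [hΨ]

/-- Compare the minimizer with the mixed plan (1-t)μ + tu, divide by `t` and let `t` tend to zero.
This yields first-order optimality with a divergence gain without differentiating the potential,
whose slope is infinite at zero in both applications. -/
theorem PerfectRecall.add_divLower_le [∀ x, Nonempty (A x)] (hG : G.PerfectRecall) {ψ : ℝ → ℝ}
    {q κ η : ℝ} (hψ : IsPotential ψ q κ) (hη : 0 < η) {L : (Σ x, A x) → ℝ}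
    {μ u : ∀ x, A x → ℝ} (hμ : μ ∈ Policies A) (hu : u ∈ Policies A)
    (hmin : IsMinOn (fun μ => ∑ z, G.plan μ z * L z + G.potential ψ μ / η) (Policies A) μ) :
    ∑ z, G.plan μ z * L z + G.potential ψ μ / η +
        ∑ z, divLower q κ (G.pstar z.1 * G.plan u z) (G.pstar z.1 * G.plan μ z) / η ≤
      ∑ z, G.plan u z * L z + G.potential ψ u / η := by
  set D := ∑ z, divLower q κ (G.pstar z.1 * G.plan u z) (G.pstar z.1 * G.plan μ z) / η with hD
  rw [← le_sub_iff_add_le']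
  refine le_of_forall_one_sub_mul_le fun t ht0 ht1 => ?_
  obtain ⟨m, hm, hplan⟩ := hG.exists_plan_eq_combination hμ hu ht0 ht1
  have h1 := hmin hm
  simp only [Set.mem_ofPred_eq] at h1
  have h2 : ∑ z, G.plan m z * L z =
      (1 - t) * ∑ z, G.plan μ z * L z + t * ∑ z, G.plan u z * L z := by
    rw [Finset.mul_sum, Finset.mul_sum, ← Finset.sum_add_distrib]
    refine Finset.sum_congr rfl fun z _ => ?_
    rw [hplan]
    ring
  have h3 : G.potential ψ m / η ≤ (1 - t) * (G.potential ψ μ / η) + t * (G.potential ψ u / η) -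
      t * (1 - t) * D := by
    simp only [hD, potential, Finset.sum_div, Finset.mul_sum]
    rw [← Finset.sum_add_distrib, ← Finset.sum_sub_distrib]
    refine Finset.sum_le_sum fun z _ => ?_
    have := div_le_div_of_nonneg_right (hψ.apply_combination_le (hG.pstar_mul_plan_nonneg hu z)
      (hG.pstar_mul_plan_nonneg hμ z) ht0 ht1) hη.le
    rw [hplan, show G.pstar z.1 * ((1 - t) * G.plan μ z + t * G.plan u z) =
      (1 - t) * (G.pstar z.1 * G.plan μ z) + t * (G.pstar z.1 * G.plan u z) by ring]
    refine this.trans (le_of_eq ?_)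
    ring
  refine le_of_mul_le_mul_left ?_ ht0
  linarith

/-- Regret bound of follow-the-regularized-leader over realization plans, for
non-negative losses. -/
theorem PerfectRecall.ftrl_regret_le [∀ x, Nonempty (A x)] (hG : G.PerfectRecall) {ψ : ℝ → ℝ}
    {q κ η : ℝ} (hψ : IsPotential ψ q κ) (hη : 0 < η) {T : ℕ} (hT : 0 < T)
    {μ : ℕ → ∀ x, A x → ℝ} (hμ : ∀ t < T, μ t ∈ Policies A)
    {l : ℕ → (Σ x, A x) → ℝ} (hl : ∀ t < T, ∀ z, 0 ≤ l t z)
    (hmin : ∀ t < T, IsMinOn (fun μ => ∑ z, G.plan μ z * ∑ k ∈ Finset.range t, l k z +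
      G.potential ψ μ / η) (Policies A) (μ t))
    {u : ∀ x, A x → ℝ} (hu : u ∈ Policies A) :
    ∑ t ∈ Finset.range T, ∑ z, (G.plan (μ t) z - G.plan u z) * l t z ≤
      (G.potential ψ u - G.potential ψ (μ 0)) / η +
      ∑ t ∈ Finset.range T, ∑ z, η * κ / 2 *
        ((G.pstar z.1 * G.plan (μ t) z) ^ (2 - q) * (l t z / G.pstar z.1) ^ 2) := by
  set stab : ℕ → ℝ := fun t => ∑ z, η * κ / 2 *
    ((G.pstar z.1 * G.plan (μ t) z) ^ (2 - q) * (l t z / G.pstar z.1) ^ 2) with hstab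
  have key : ∀ t ≤ T, ∀ u ∈ Policies A, G.potential ψ (μ 0) / η +
      ∑ k ∈ Finset.range t, (∑ z, G.plan (μ k) z * l k z - stab k) ≤
      ∑ z, G.plan u z * ∑ k ∈ Finset.range t, l k z + G.potential ψ u / η := by
    intro t
    induction t with
    | zero =>
      intro _ u hu
      have := hmin 0 hT hu
      simpa using this
    | succ t ih =>
      intro ht u hu
      -- Be-the-leader induction: the hypothesis is used with comparator `μ t`, and the divergence
      -- gain from moving to `u` pays for the new loss up to `stab t`.
      have h1 := ih (by omega) (μ t) (hμ t (by omega))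
      have h2 := hG.add_divLower_le hψ hη (hμ t (by omega)) hu (hmin t (by omega))
      have h3 : ∑ z, G.plan (μ t) z * l t z - ∑ z, G.plan u z * l t z -
          ∑ z, divLower q κ (G.pstar z.1 * G.plan u z) (G.pstar z.1 * G.plan (μ t) z) / η ≤
          stab t := by
        rw [← Finset.sum_sub_distrib, ← Finset.sum_sub_distrib]
        refine Finset.sum_le_sum fun z _ => ?_
        have hp := hG.pstar_pos z.1
        have := mul_sub_divLower_le (q := q) hψ.κ_pos hη
          (hG.pstar_mul_plan_nonneg (hμ t (by omega)) z)
          (hG.pstar_mul_plan_nonneg hu z) (div_nonneg (hl t (by omega) z) hp.le)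
        refine le_trans (le_of_eq ?_) this
        congr 1
        field_simp
      simp only [Finset.sum_range_succ, mul_add, Finset.sum_add_distrib]
      linarith
  have h := key T le_rfl u hu
  have h4 : ∑ t ∈ Finset.range T, ∑ z, (G.plan (μ t) z - G.plan u z) * l t z =
      ∑ t ∈ Finset.range T, ∑ z, G.plan (μ t) z * l t z -
        ∑ z, G.plan u z * ∑ k ∈ Finset.range T, l k z := by
    simp only [sub_mul, Finset.sum_sub_distrib, Finset.mul_sum]
    rw [Finset.sum_comm (s := Finset.univ) (t := Finset.range T)]
  rw [Finset.sum_sub_distrib] at h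
  rw [h4, sub_div]
  linarith

end FTRL

end IIG

/-! ### Exponential supermartingales and tail bounds -/

section ExponentialSupermartingale

variable {Ω C : Type*} {mΩ : MeasurableSpace Ω} {P : Measure Ω} {ℱ : Filtration ℕ mΩ} [Fintype C]
  {T : ℕ} {τ : ℕ → Ω → C} {p g : ℕ → Ω → C → ℝ}

theorem apply_eq_sum_indicator (f : Ω → C → ℝ) (τ : Ω → C) (ω : Ω) :
    f ω (τ ω) = ∑ σ, {ω | τ ω = σ}.indicator (fun ω => f ω σ) ω := by
  classical
  rw [Finset.sum_eq_single (τ ω)]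
  · simp
  · intro σ _ hne
    exact Set.indicator_of_notMem (fun h => hne (Eq.symm h)) _
  · simp

theorem measurable_apply {m : MeasurableSpace Ω} {f : Ω → C → ℝ} {τ : Ω → C}
    (hf : ∀ σ, Measurable fun ω => f ω σ) (hτ : ∀ σ, MeasurableSet {ω | τ ω = σ}) :
    Measurable fun ω => f ω (τ ω) := by
  simp only [apply_eq_sum_indicator f τ]
  exact Finset.measurable_fun_sum _ fun σ _ => (hf σ).indicator (hτ σ)

variable [IsProbabilityMeasure P]

/-- One step: the conditional law of `τ` given `m` is `p`. -/
theorem integral_mul_apply_le {m : MeasurableSpace Ω} (hm : m ≤ mΩ) {Z : Ω → ℝ} {τ : Ω → C}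
    {p f : Ω → C → ℝ} (hτ : ∀ σ, MeasurableSet[mΩ] {ω | τ ω = σ})
    (hp : ∀ σ, P[Set.indicator {ω | τ ω = σ} (fun _ => (1 : ℝ)) | m] =ᵐ[P] fun ω => p ω σ)
    (hZ : Measurable[m] Z) (hZ0 : ∀ ω, 0 ≤ Z ω) {K : ℝ} (hZK : ∀ ω, Z ω ≤ K)
    (hf : ∀ σ, Measurable[m] fun ω => f ω σ) (hf0 : ∀ ω σ, 0 ≤ f ω σ) {K' : ℝ}
    (hfK : ∀ ω σ, f ω σ ≤ K') (hpf : ∀ ω, ∑ σ, p ω σ * f ω σ ≤ 1) :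
    ∫ ω, Z ω * f ω (τ ω) ∂P ≤ ∫ ω, Z ω ∂P := by
  have hbd : ∀ σ ω, ‖Z ω * f ω σ‖ ≤ K * K' := fun σ ω => by
    rw [Real.norm_of_nonneg (mul_nonneg (hZ0 ω) (hf0 ω σ))]
    exact mul_le_mul (hZK ω) (hfK ω σ) (hf0 ω σ) ((hZ0 ω).trans (hZK ω))
  have hms : ∀ σ, Measurable[m] fun ω => Z ω * f ω σ := fun σ => hZ.mul (hf σ)
  have hint : ∀ σ, Integrable (fun ω => Z ω * f ω σ) P := fun σ =>
    Integrable.of_bound ((hms σ).mono hm le_rfl).aestronglyMeasurable _ (ae_of_all _ (hbd σ))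
  have h1 : ∀ σ, Integrable (Set.indicator {ω | τ ω = σ} (fun _ => (1 : ℝ))) P := fun σ =>
    (integrable_const 1).indicator (hτ σ)
  have e : ∀ σ ω, {ω | τ ω = σ}.indicator (fun ω => Z ω * f ω σ) ω =
      ((fun ω => Z ω * f ω σ) * Set.indicator {ω | τ ω = σ} (fun _ => (1 : ℝ))) ω := by
    intro σ ω
    by_cases h : ω ∈ {ω | τ ω = σ}
    · rw [Set.indicator_of_mem h, Pi.mul_apply, Set.indicator_of_mem h, mul_one]
    · rw [Set.indicator_of_notMem h, Pi.mul_apply, Set.indicator_of_notMem h, mul_zero]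
  have hint2 : ∀ σ, Integrable ((fun ω => Z ω * f ω σ) *
      Set.indicator {ω | τ ω = σ} (fun _ => (1 : ℝ))) P := fun σ =>
    ((hint σ).indicator (hτ σ)).congr (ae_of_all _ (e σ))
  have hcond : ∀ σ, P[(fun ω => Z ω * f ω σ) * Set.indicator {ω | τ ω = σ} (fun _ => (1 : ℝ)) | m]
      =ᵐ[P] fun ω => Z ω * f ω σ * p ω σ := fun σ =>
    (condExp_mul_of_stronglyMeasurable_left (hms σ).stronglyMeasurable (hint2 σ) (h1 σ)).trans
      ((hp σ).mono fun ω h => by simp only [Pi.mul_apply]; rw [h])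
  have hint3 : ∀ σ, Integrable (fun ω => Z ω * f ω σ * p ω σ) P := fun σ =>
    integrable_condExp.congr (hcond σ)
  -- The run takes finitely many values: split over them and pull the `m`-measurable factors out of
  -- each conditional expectation.
  calc ∫ ω, Z ω * f ω (τ ω) ∂P
      = ∫ ω, ∑ σ, ((fun ω => Z ω * f ω σ) *
          Set.indicator {ω | τ ω = σ} (fun _ => (1 : ℝ))) ω ∂P := by
        refine integral_congr_ae (ae_of_all _ fun ω => ?_)
        simp only [← e]
        exact apply_eq_sum_indicator (fun ω σ => Z ω * f ω σ) τ ω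
    _ = ∑ σ, ∫ ω, ((fun ω => Z ω * f ω σ) *
          Set.indicator {ω | τ ω = σ} (fun _ => (1 : ℝ))) ω ∂P :=
        integral_finsetSum _ fun σ _ => hint2 σ
    _ = ∑ σ, ∫ ω, Z ω * f ω σ * p ω σ ∂P := by
        refine Finset.sum_congr rfl fun σ _ => ?_
        rw [← integral_condExp hm]
        exact integral_congr_ae (hcond σ)
    _ = ∫ ω, ∑ σ, Z ω * f ω σ * p ω σ ∂P := (integral_finsetSum _ fun σ _ => hint3 σ).symm
    _ ≤ ∫ ω, Z ω ∂P := by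
        refine integral_mono (integrable_finsetSum _ fun σ _ => hint3 σ) ?_ fun ω => ?_
        · refine Integrable.of_bound (hZ.mono hm le_rfl).aestronglyMeasurable K
            (ae_of_all _ fun ω => ?_)
          rw [Real.norm_of_nonneg (hZ0 ω)]
          exact hZK ω
        · have := mul_le_mul_of_nonneg_left (hpf ω) (hZ0 ω)
          rw [mul_one, Finset.mul_sum] at this
          refine le_trans (le_of_eq (Finset.sum_congr rfl fun σ _ => ?_)) this
          ring

theorem measurable_sum_apply (hτ : ∀ t < T, ∀ σ, MeasurableSet[ℱ (t + 1)] {ω | τ t ω = σ})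
    (hg : ∀ t < T, ∀ σ, Measurable[ℱ t] fun ω => g t ω σ) {n : ℕ} (hn : n ≤ T) :
    Measurable[ℱ n] fun ω => ∑ t ∈ Finset.range n, g t ω (τ t ω) := by
  refine Finset.measurable_fun_sum _ fun t ht => ?_
  have htn := Finset.mem_range.1 ht
  exact (measurable_apply (m := ℱ (t + 1)) (fun σ => (hg t (by omega) σ).mono
    (ℱ.mono (Nat.le_succ t)) le_rfl) (hτ t (by omega))).mono (ℱ.mono htn) le_rfl

/-- Peel off the last episode: given the past, its exponential factor has mean at most one. -/
theorem integral_exp_sum_le_one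
    (hτ : ∀ t < T, ∀ σ, MeasurableSet[ℱ (t + 1)] {ω | τ t ω = σ})
    (hp : ∀ t < T, ∀ σ, P[Set.indicator {ω | τ t ω = σ} (fun _ => (1 : ℝ)) | ℱ t]
      =ᵐ[P] fun ω => p t ω σ)
    (hg : ∀ t < T, ∀ σ, Measurable[ℱ t] fun ω => g t ω σ) {K : ℝ}
    (hK : ∀ t < T, ∀ ω σ, g t ω σ ≤ K)
    (hpg : ∀ t < T, ∀ ω, ∑ σ, p t ω σ * Real.exp (g t ω σ) ≤ 1) {n : ℕ} (hn : n ≤ T) :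
    ∫ ω, Real.exp (∑ t ∈ Finset.range n, g t ω (τ t ω)) ∂P ≤ 1 := by
  induction n with
  | zero => simp
  | succ n ih =>
    refine le_trans ?_ (ih (by omega))
    simp only [Finset.sum_range_succ, Real.exp_add]
    refine integral_mul_apply_le (ℱ.le n) (f := fun ω σ => Real.exp (g n ω σ))
      (fun σ => ℱ.le _ _ (hτ n (by omega) σ)) (hp n (by omega))
      ((measurable_sum_apply hτ hg (by omega)).exp) (fun ω => (Real.exp_pos _).le)
      (K := Real.exp (n * K)) (fun ω => ?_) (fun σ => (hg n (by omega) σ).exp)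
      (fun ω σ => (Real.exp_pos _).le) (K' := Real.exp K)
      (fun ω σ => Real.exp_le_exp.2 (hK n (by omega) ω σ)) (hpg n (by omega))
    refine Real.exp_le_exp.2 ?_
    refine (Finset.sum_le_card_nsmul _ _ K fun t ht => hK t ?_ ω _).trans (by simp)
    have := Finset.mem_range.1 ht
    omega

/-- Tail bound for a sum whose exponential is a supermartingale. -/
theorem measureReal_lt_sum_le
    (hτ : ∀ t < T, ∀ σ, MeasurableSet[ℱ (t + 1)] {ω | τ t ω = σ})
    (hp : ∀ t < T, ∀ σ, P[Set.indicator {ω | τ t ω = σ} (fun _ => (1 : ℝ)) | ℱ t]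
      =ᵐ[P] fun ω => p t ω σ)
    (hg : ∀ t < T, ∀ σ, Measurable[ℱ t] fun ω => g t ω σ) {K : ℝ}
    (hK : ∀ t < T, ∀ ω σ, g t ω σ ≤ K)
    (hpg : ∀ t < T, ∀ ω, ∑ σ, p t ω σ * Real.exp (g t ω σ) ≤ 1) (ι : ℝ) :
    P.real {ω | ι < ∑ t ∈ Finset.range T, g t ω (τ t ω)} ≤ Real.exp (-ι) := by
  have hmeas := (measurable_sum_apply hτ hg le_rfl).mono (ℱ.le T) le_rfl
  have hint : Integrable (fun ω => Real.exp (∑ t ∈ Finset.range T, g t ω (τ t ω))) P := by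
    refine Integrable.of_bound hmeas.exp.aestronglyMeasurable (Real.exp (T * K))
      (ae_of_all _ fun ω => ?_)
    rw [Real.norm_of_nonneg (Real.exp_pos _).le]
    refine Real.exp_le_exp.2 ?_
    exact (Finset.sum_le_card_nsmul _ _ K fun t ht => hK t (Finset.mem_range.1 ht) ω _).trans
      (by simp)
  have hmarkov := mul_meas_ge_le_integral_of_nonneg (ae_of_all _ fun ω => (Real.exp_pos _).le)
    hint (Real.exp ι)
  have hle := hmarkov.trans (integral_exp_sum_le_one hτ hp hg hK hpg le_rfl)
  rw [Real.exp_neg, ← one_div, le_div_iff₀' (Real.exp_pos ι)]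
  refine le_trans (mul_le_mul_of_nonneg_left (measureReal_mono ?_) (Real.exp_pos ι).le) hle
  intro ω hω
  exact Real.exp_le_exp.2 (le_of_lt hω)

end ExponentialSupermartingale

/-! ### Implicit-exploration estimates and their exponential moments -/

/-- With x = 2γy/w, the bound 2x/(x+2) ≤ log(1+x) has left side 2γy/(w+γy), and y ≤ 1 permits
replacing γy by γ in the denominator. Bernoulli's inequality for the exponent β then finishes. -/
theorem exp_mul_ix_le {β γ w y : ℝ} (hβ0 : 0 ≤ β) (hβ1 : β ≤ 1) (hγ : 0 < γ) (hw : 0 < w)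
    (hy0 : 0 ≤ y) (hy1 : y ≤ 1) :
    Real.exp (β * (2 * γ * y / (w + γ))) ≤ 1 + β * (2 * γ * y / w) := by
  have hx : 0 ≤ 2 * γ * y / w := by positivity
  have h1 : 2 * γ * y / (w + γ) ≤ Real.log (1 + 2 * γ * y / w) := by
    refine le_trans ?_ (Real.le_log_one_add_of_nonneg hx)
    have e : 2 * (2 * γ * y / w) / (2 * γ * y / w + 2) = 2 * γ * y / (w + γ * y) := by
      have : 0 < w + γ * y := by positivity
      field_simp
      ring
    rw [e]
    refine div_le_div_of_nonneg_left (by positivity) (by positivity) ?_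
    nlinarith
  calc Real.exp (β * (2 * γ * y / (w + γ)))
      ≤ Real.exp (β * Real.log (1 + 2 * γ * y / w)) :=
        Real.exp_le_exp.2 (mul_le_mul_of_nonneg_left h1 hβ0)
    _ = (1 + 2 * γ * y / w) ^ β := by
        rw [Real.rpow_def_of_pos (by linarith), mul_comm]
    _ ≤ _ := rpow_one_add_le_one_add_mul_self (by linarith) hβ0 hβ1

/-- Invert exp x ≥ 1 + x + x²/2 and use (1 + x + x²/2)(1 - x + x²/2) = 1 + x⁴/4. -/
theorem exp_neg_le_quadratic {x : ℝ} (hx : 0 ≤ x) : Real.exp (-x) ≤ 1 - x + x ^ 2 / 2 := by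
  have h1 := Real.quadratic_le_exp_of_nonneg hx
  have h2 : 0 < 1 + x + x ^ 2 / 2 := by positivity
  rw [Real.exp_neg]
  refine (inv_anti₀ h2 h1).trans ?_
  rw [inv_le_iff_one_le_mul₀ h2]
  nlinarith [sq_nonneg (x ^ 2)]

theorem measurable_policy_apply {Ω X : Type*} {m : MeasurableSpace Ω} {A : X → Type*}
    {μ : Ω → ∀ x, A x → ℝ} (hμ : Measurable μ) (x : X) (a : A x) :
    Measurable fun ω => μ ω x a :=
  (measurable_pi_apply a).comp ((measurable_pi_apply x).comp hμ)

namespace IIG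

section Estimate

open scoped Classical

variable {S X Y : Type*} [Fintype S] [Fintype X] {A : X → Type*} {B : Y → Type*}
  [∀ x, Fintype (A x)] [∀ y, Fintype (B y)] {G : IIG S X Y A B}

theorem lossEst_eq {γ : ℝ} (μ : ∀ x, A x → ℝ) (σ : G.Traj) {z : Σ x, A x} {h : Fin G.H}
    (hz : G.depth z.1 = h) :
    G.lossEst (fun _ => γ) μ σ z = if G.obs (σ h) = z then
      (1 - G.reward σ h) / (G.plan μ z + γ / G.pstar z.1) else 0 := by
  rw [lossEst, Finset.sum_eq_single h]
  · simp [hz]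
  · intro b _ hne
    refine if_neg fun hb => hne (Fin.ext ?_)
    rw [hb.1, hz]
  · simp

variable [∀ x, Nonempty (A x)]

theorem PerfectRecall.plan_add_pos (hG : G.PerfectRecall) {γ : ℝ} (hγ : 0 < γ)
    {μ : ∀ x, A x → ℝ} (hμ : μ ∈ Policies A) (z : Σ x, A x) :
    0 < G.plan μ z + γ / G.pstar z.1 :=
  add_pos_of_nonneg_of_pos (plan_nonneg hμ z) (div_pos hγ (hG.pstar_pos _))

theorem PerfectRecall.lossEst_nonneg (hG : G.PerfectRecall) {γ : ℝ} (hγ : 0 < γ)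
    {μ : ∀ x, A x → ℝ} (hμ : μ ∈ Policies A) (σ : G.Traj) (z : Σ x, A x) :
    0 ≤ G.lossEst (fun _ => γ) μ σ z := by
  rw [lossEst_eq μ σ (h := ⟨G.depth z.1, hG.depth_lt z.1⟩) rfl]
  split_ifs
  · exact div_nonneg (sub_nonneg.2 (reward_mem σ _).2) (hG.plan_add_pos hγ hμ z).le
  · exact le_rfl

theorem PerfectRecall.lossEst_le (hG : G.PerfectRecall) {γ : ℝ} (hγ : 0 < γ)
    {μ : ∀ x, A x → ℝ} (hμ : μ ∈ Policies A) (σ : G.Traj) (z : Σ x, A x) :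
    G.lossEst (fun _ => γ) μ σ z ≤ 1 / (G.plan μ z + γ / G.pstar z.1) := by
  have hp := hG.plan_add_pos hγ hμ z
  rw [lossEst_eq μ σ (h := ⟨G.depth z.1, hG.depth_lt z.1⟩) rfl]
  split_ifs
  · exact div_le_div_of_nonneg_right (sub_le_self _ (reward_mem σ _).1) hp.le
  · positivity

theorem PerfectRecall.plan_mul_lossEst_le (hG : G.PerfectRecall) {γ : ℝ} (hγ : 0 < γ)
    {μ : ∀ x, A x → ℝ} (hμ : μ ∈ Policies A) (σ : G.Traj) (z : Σ x, A x) :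
    G.plan μ z * G.lossEst (fun _ => γ) μ σ z ≤ 1 := by
  have hp := hG.plan_add_pos hγ hμ z
  refine (mul_le_mul_of_nonneg_left (hG.lossEst_le hγ hμ σ z) (plan_nonneg hμ z)).trans ?_
  rw [mul_one_div, div_le_one hp]
  exact le_add_of_nonneg_right (div_pos hγ (hG.pstar_pos _)).le

theorem PerfectRecall.lossEst_le_div (hG : G.PerfectRecall) {γ : ℝ} (hγ : 0 < γ)
    {μ : ∀ x, A x → ℝ} (hμ : μ ∈ Policies A) (σ : G.Traj) (z : Σ x, A x) :
    γ / G.pstar z.1 * G.lossEst (fun _ => γ) μ σ z ≤ 1 := by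
  have hp := hG.plan_add_pos hγ hμ z
  refine (mul_le_mul_of_nonneg_left (hG.lossEst_le hγ hμ σ z)
    (div_pos hγ (hG.pstar_pos _)).le).trans ?_
  rw [mul_one_div, div_le_one hp]
  exact le_add_of_nonneg_left (plan_nonneg hμ z)

/-- At each depth only the visited pair has a nonzero estimate, and its contribution is at most one.
-/
theorem PerfectRecall.sum_plan_mul_lossEst_le (hG : G.PerfectRecall) {γ : ℝ} (hγ : 0 < γ)
    {μ : ∀ x, A x → ℝ} (hμ : μ ∈ Policies A) (σ : G.Traj) :
    ∑ z, G.plan μ z * G.lossEst (fun _ => γ) μ σ z ≤ G.H := by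
  rw [hG.sum_eq_sum_depth]
  refine (Finset.sum_le_card_nsmul _ _ 1 fun h hh => ?_).trans (by simp)
  have hh' := Finset.mem_range.1 hh
  have : ∀ z ∈ (Finset.univ.filter fun z : (Σ x, A x) => G.depth z.1 = h),
      z ≠ G.obs (σ ⟨h, hh'⟩) → G.plan μ z * G.lossEst (fun _ => γ) μ σ z = 0 := by
    intro z hz hne
    rw [lossEst_eq μ σ (h := ⟨h, hh'⟩) (Finset.mem_filter.1 hz).2, if_neg (Ne.symm hne), mul_zero]
  by_cases hmem : G.obs (σ ⟨h, hh'⟩) ∈ Finset.univ.filter fun z : (Σ x, A x) => G.depth z.1 = h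
  · rw [Finset.sum_eq_single_of_mem _ hmem this]
    exact hG.plan_mul_lossEst_le hγ hμ σ _
  · rw [Finset.sum_eq_zero fun z hz => this z hz fun he => hmem (he ▸ hz)]
    exact zero_le_one

theorem PerfectRecall.sum_trajProb_mul_lossEst (hG : G.PerfectRecall) {γ : ℝ}
    {μ : ∀ x, A x → ℝ} {ν : ∀ y, B y → ℝ} (hμ : μ ∈ Policies A) (hν : ν ∈ Policies B)
    (z : Σ x, A x) :
    ∑ σ : G.Traj, G.trajProb μ ν σ * G.lossEst (fun _ => γ) μ σ z =
      G.plan μ z * G.lossVec ν z / (G.plan μ z + γ / G.pstar z.1) := by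
  have h := hG.sum_trajProb_mul_loss hμ hν ⟨G.depth z.1, hG.depth_lt z.1⟩
    fun z' => if z' = z then 1 / (G.plan μ z + γ / G.pstar z.1) else 0
  rw [Finset.sum_eq_single_of_mem z (by simp) fun z' _ hne => by rw [if_neg hne, mul_zero],
    if_pos rfl, mul_one_div] at h
  rw [← h]
  refine Finset.sum_congr rfl fun σ _ => ?_
  rw [lossEst_eq μ σ (h := ⟨G.depth z.1, hG.depth_lt z.1⟩) rfl]
  split_ifs
  · ring
  · ring

/-- Exponential moment of the implicit-exploration estimates at one depth. -/
theorem PerfectRecall.sum_trajProb_mul_exp_ix_le (hG : G.PerfectRecall) {γ : ℝ} (hγ : 0 < γ)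
    {μ : ∀ x, A x → ℝ} {ν : ∀ y, B y → ℝ} (hμ : μ ∈ Policies A) (hν : ν ∈ Policies B)
    {β : (Σ x, A x) → ℝ} (hβ0 : ∀ z, 0 ≤ β z) (hβ1 : ∀ z, β z ≤ 1) (h : Fin G.H) :
    ∑ σ : G.Traj, G.trajProb μ ν σ * Real.exp (∑ z : (Σ x, A x) with G.depth z.1 = h,
      2 * γ * β z / G.pstar z.1 * (G.lossEst (fun _ => γ) μ σ z - G.lossVec ν z)) ≤ 1 := by
  set s := ∑ z : (Σ x, A x) with G.depth z.1 = h, 2 * γ * β z / G.pstar z.1 * G.lossVec ν z with hs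
  set E : G.Step → ℝ := fun c => if G.depth (G.obs c).1 = h then
    β (G.obs c) * (2 * γ * (1 - G.r h c.1 c.2.1 c.2.2) /
      (G.pstar (G.obs c).1 * G.plan μ (G.obs c) + γ)) else 0 with hE
  set φ : (Σ x, A x) → ℝ := fun z => β z * (2 * γ / (G.pstar z.1 * G.plan μ z)) with hφ
  have hφ0 : ∀ z, 0 ≤ φ z := fun z => mul_nonneg (hβ0 z)
    (div_nonneg (by linarith) (hG.pstar_mul_plan_nonneg hμ z))
  have h1 : ∀ σ : G.Traj, ∑ z : (Σ x, A x) with G.depth z.1 = h,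
      2 * γ * β z / G.pstar z.1 * G.lossEst (fun _ => γ) μ σ z = E (σ h) := by
    intro σ
    have hzero : ∀ z ∈ (Finset.univ.filter fun z : (Σ x, A x) => G.depth z.1 = h),
        z ≠ G.obs (σ h) → 2 * γ * β z / G.pstar z.1 * G.lossEst (fun _ => γ) μ σ z = 0 := by
      intro z hz hne
      rw [lossEst_eq μ σ (Finset.mem_filter.1 hz).2, if_neg (Ne.symm hne), mul_zero]
    by_cases hd : G.depth (G.obs (σ h)).1 = h
    · rw [Finset.sum_eq_single_of_mem _ (by simpa using hd) hzero, lossEst_eq μ σ hd, if_pos rfl]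
      simp only [hE, if_pos hd]
      have hp := hG.pstar_pos (G.obs (σ h)).1
      have hq := hG.plan_add_pos hγ hμ (G.obs (σ h))
      have hw : 0 < G.pstar (G.obs (σ h)).1 * G.plan μ (G.obs (σ h)) + γ :=
        add_pos_of_nonneg_of_pos (hG.pstar_mul_plan_nonneg hμ _) hγ
      have e : G.plan μ (G.obs (σ h)) + γ / G.pstar (G.obs (σ h)).1 =
          (G.pstar (G.obs (σ h)).1 * G.plan μ (G.obs (σ h)) + γ) / G.pstar (G.obs (σ h)).1 := by
        field_simp
      rw [e, reward]
      field_simp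
    · rw [Finset.sum_eq_zero fun z hz => hzero z hz fun he => hd (by
        rw [← he]; exact (Finset.mem_filter.1 hz).2)]
      simp only [hE, if_neg hd]
  have h2 : ∑ σ : G.Traj, G.trajProb μ ν σ * Real.exp (E (σ h)) ≤ 1 + s := by
    rw [hG.sum_trajProb_mul hμ hν h fun c => Real.exp (E c)]
    calc _ ≤ ∑ c : G.Step, G.plan μ (G.obs c) * G.occ ν h c.1 * ν (G.yinfo c.1) c.2.2 *
          (1 + φ (G.obs c) * (1 - G.r h c.1 c.2.1 c.2.2)) := by
          refine Finset.sum_le_sum fun c _ => ?_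
          have hr := G.r_mem h h.2 c.1 c.2.1 c.2.2
          have hn := plan_nonneg (G := G) hμ (G.obs c)
          -- `φ` divides by the plan. Where the plan vanishes the step has weight zero, so the
          -- default value of the division is harmless.
          rcases hn.eq_or_lt with h0 | hpos
          · rw [← h0]
            simp
          · refine mul_le_mul_of_nonneg_left ?_ (mul_nonneg (mul_nonneg hn (occ_nonneg hν h.2 _))
              ((hν _).1 _))
            simp only [hE]
            split_ifs with hd
            · refine (exp_mul_ix_le (hβ0 _) (hβ1 _) hγ (mul_pos (hG.pstar_pos _) hpos)
                (sub_nonneg.2 hr.2) (sub_le_self _ hr.1)).trans (le_of_eq ?_)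
              simp only [hφ]
              ring
            · rw [Real.exp_zero]
              exact le_add_of_nonneg_right (mul_nonneg (hφ0 _) (sub_nonneg.2 hr.2))
      _ = ∑ σ : G.Traj, G.trajProb μ ν σ * (1 + φ (G.obs (σ h)) * (1 - G.reward σ h)) :=
          (hG.sum_trajProb_mul hμ hν h
            fun c => 1 + φ (G.obs c) * (1 - G.r h c.1 c.2.1 c.2.2)).symm
      _ = 1 + ∑ z : (Σ x, A x) with G.depth z.1 = h, G.plan μ z * G.lossVec ν z * φ z := by
          simp only [mul_add, mul_one, Finset.sum_add_distrib, hG.sum_trajProb hμ hν]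
          rw [hG.sum_trajProb_mul_loss hμ hν]
      _ ≤ 1 + s := by
          refine add_le_add_right (Finset.sum_le_sum fun z _ => ?_) _
          have hl := hG.lossVec_nonneg hν z
          have hp := hG.pstar_pos z.1
          have hr : 0 ≤ 2 * γ * β z / G.pstar z.1 * G.lossVec ν z :=
            mul_nonneg (div_nonneg (mul_nonneg (by linarith) (hβ0 z)) hp.le) hl
          rcases (plan_nonneg (G := G) hμ z).eq_or_lt with h0 | hpos
          · rw [← h0, zero_mul, zero_mul]
            exact hr
          · refine le_of_eq ?_
            simp only [hφ]
            field_simp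
  calc _ = ∑ σ : G.Traj, G.trajProb μ ν σ * Real.exp (E (σ h)) * Real.exp (-s) := by
        refine Finset.sum_congr rfl fun σ _ => ?_
        simp only [mul_sub, Finset.sum_sub_distrib]
        rw [h1, ← hs, sub_eq_add_neg, Real.exp_add, mul_assoc]
    -- The moment is at most `1 + s ≤ exp s`, which the centring factor cancels.
    _ ≤ Real.exp s * Real.exp (-s) := by
        rw [← Finset.sum_mul]
        refine mul_le_mul_of_nonneg_right (h2.trans ?_) (Real.exp_pos _).le
        linarith [Real.add_one_le_exp s]
    _ = 1 := by rw [← Real.exp_add, add_neg_cancel, Real.exp_zero]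

/-- Expectation of the estimated loss of the policy that is played. -/
noncomputable def meanEst (G : IIG S X Y A B) (γ : ℝ) (μ : ∀ x, A x → ℝ) (ν : ∀ y, B y → ℝ) : ℝ :=
  ∑ z, G.plan μ z * (G.plan μ z * G.lossVec ν z / (G.plan μ z + γ / G.pstar z.1))

/-- With d = γ/p⋆, implicit exploration shrinks the loss at a pair by the factor plan/(plan + d).
The played policy thus loses at most d · loss there, and the balanced mass bound sums these. -/
theorem PerfectRecall.sum_plan_mul_lossVec_sub_meanEst_le (hG : G.PerfectRecall) {γ : ℝ}
    (hγ : 0 < γ) {μ : ∀ x, A x → ℝ} {ν : ∀ y, B y → ℝ} (hμ : μ ∈ Policies A)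
    (hν : ν ∈ Policies B) :
    ∑ z, G.plan μ z * G.lossVec ν z - G.meanEst γ μ ν ≤ γ * G.AX := by
  rw [meanEst, ← Finset.sum_sub_distrib]
  refine le_trans ?_ (mul_le_mul_of_nonneg_left (hG.sum_lossVec_div_pstar_le hν) hγ.le)
  rw [Finset.mul_sum]
  refine Finset.sum_le_sum fun z _ => ?_
  have hp := hG.pstar_pos z.1
  have hl := hG.lossVec_nonneg hν z
  have hn := plan_nonneg (G := G) hμ z
  have hq := hG.plan_add_pos hγ hμ z
  set d := γ / G.pstar z.1 with hd
  have hd0 : 0 < d := div_pos hγ hp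
  have e : G.plan μ z * G.lossVec ν z - G.plan μ z * (G.plan μ z * G.lossVec ν z /
      (G.plan μ z + d)) = d * G.lossVec ν z * (G.plan μ z / (G.plan μ z + d)) := by
    field_simp
    ring
  rw [e, show γ * (G.lossVec ν z / G.pstar z.1) = d * G.lossVec ν z by rw [hd]; ring]
  refine mul_le_of_le_one_right (mul_nonneg hd0.le hl) ?_
  rw [div_le_one hq]
  linarith

theorem PerfectRecall.meanEst_le (hG : G.PerfectRecall) {γ : ℝ}
    (hγ : 0 < γ) {μ : ∀ x, A x → ℝ} {ν : ∀ y, B y → ℝ} (hμ : μ ∈ Policies A)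
    (hν : ν ∈ Policies B) : G.meanEst γ μ ν ≤ G.H := by
  refine le_trans (Finset.sum_le_sum fun z _ => ?_) (hG.sum_plan_mul_lossVec_le hμ hν)
  have hl := hG.lossVec_nonneg hν z
  have hn := plan_nonneg (G := G) hμ z
  have hq := hG.plan_add_pos hγ hμ z
  refine mul_le_mul_of_nonneg_left ?_ hn
  rw [mul_comm, mul_div_assoc]
  refine mul_le_of_le_one_right hl ?_
  rw [div_le_one hq]
  exact le_add_of_nonneg_right (div_pos hγ (hG.pstar_pos _)).le

/-- Exponential moment of the lower deviation of the estimated loss. -/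
theorem PerfectRecall.sum_trajProb_mul_exp_meanEst_le (hG : G.PerfectRecall) {γ lam : ℝ}
    (hγ : 0 < γ) (hlam : 0 ≤ lam) {μ : ∀ x, A x → ℝ} {ν : ∀ y, B y → ℝ} (hμ : μ ∈ Policies A)
    (hν : ν ∈ Policies B) :
    ∑ σ : G.Traj, G.trajProb μ ν σ * Real.exp (lam * (G.meanEst γ μ ν -
      ∑ z, G.plan μ z * G.lossEst (fun _ => γ) μ σ z) - lam ^ 2 * G.H ^ 2 / 2) ≤ 1 := by
  set x : G.Traj → ℝ := fun σ => ∑ z, G.plan μ z * G.lossEst (fun _ => γ) μ σ z with hx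
  set m := G.meanEst γ μ ν with hm
  have hx0 : ∀ σ, 0 ≤ x σ := fun σ => Finset.sum_nonneg fun z _ =>
    mul_nonneg (plan_nonneg hμ z) (hG.lossEst_nonneg hγ hμ σ z)
  have hxH : ∀ σ, x σ ≤ G.H := hG.sum_plan_mul_lossEst_le hγ hμ
  have hmean : ∑ σ : G.Traj, G.trajProb μ ν σ * x σ = m := by
    simp only [hx, hm, meanEst, Finset.mul_sum]
    rw [Finset.sum_comm]
    refine Finset.sum_congr rfl fun z _ => ?_
    rw [← hG.sum_trajProb_mul_lossEst hμ hν, Finset.mul_sum]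
    exact Finset.sum_congr rfl fun σ _ => by ring
  set a := lam * m - lam ^ 2 * G.H ^ 2 / 2 with ha
  have h1 : ∑ σ : G.Traj, G.trajProb μ ν σ * Real.exp (-(lam * x σ)) ≤ 1 - a := by
    -- Estimates are non-negative, so the quadratic bound on exp(-x) applies for every `lam ≥ 0`;
    -- the square is controlled by `x σ ≤ H`.
    calc _ ≤ ∑ σ : G.Traj, G.trajProb μ ν σ * (1 - lam * x σ + lam ^ 2 * G.H ^ 2 / 2) := by
          refine Finset.sum_le_sum fun σ _ =>
            mul_le_mul_of_nonneg_left ?_ (trajProb_nonneg hμ hν σ)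
          refine (exp_neg_le_quadratic (mul_nonneg hlam (hx0 σ))).trans ?_
          have : (lam * x σ) ^ 2 ≤ lam ^ 2 * G.H ^ 2 := by
            rw [mul_pow]
            exact mul_le_mul_of_nonneg_left (pow_le_pow_left₀ (hx0 σ) (hxH σ) 2) (sq_nonneg _)
          linarith
      _ = ∑ σ : G.Traj, G.trajProb μ ν σ * (1 + lam ^ 2 * G.H ^ 2 / 2) -
            lam * ∑ σ : G.Traj, G.trajProb μ ν σ * x σ := by
          rw [Finset.mul_sum, ← Finset.sum_sub_distrib]
          exact Finset.sum_congr rfl fun σ _ => by ring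
      _ = 1 - a := by
          rw [← Finset.sum_mul, hG.sum_trajProb hμ hν, hmean, ha]
          ring
  calc _ = ∑ σ : G.Traj, G.trajProb μ ν σ * Real.exp (-(lam * x σ)) * Real.exp a := by
        refine Finset.sum_congr rfl fun σ _ => ?_
        rw [mul_assoc, ← Real.exp_add]
        congr 2
        rw [ha]
        ring
    _ ≤ Real.exp (-a) * Real.exp a := by
        rw [← Finset.sum_mul]
        refine mul_le_mul_of_nonneg_right (h1.trans ?_) (Real.exp_pos _).le
        linarith [Real.add_one_le_exp (-a)]
    _ = 1 := by rw [← Real.exp_add, neg_add_cancel, Real.exp_zero]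

/-- One factor w of w^(2-q), times one factor est / p⋆, equals plan · est ≤ 1. The stability term
becomes linear in the estimate and can be concentrated. -/
theorem PerfectRecall.rpow_mul_sq_lossEst_le (hG : G.PerfectRecall) {γ q : ℝ}
    (hγ : 0 < γ) (hq1 : q ≤ 1) {μ : ∀ x, A x → ℝ} (hμ : μ ∈ Policies A) (σ : G.Traj)
    (z : Σ x, A x) :
    (G.pstar z.1 * G.plan μ z) ^ (2 - q) * (G.lossEst (fun _ => γ) μ σ z / G.pstar z.1) ^ 2 ≤
      (G.pstar z.1 * G.plan μ z) ^ (1 - q) / G.pstar z.1 * G.lossEst (fun _ => γ) μ σ z := by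
  have hp := hG.pstar_pos z.1
  have hl := hG.lossEst_nonneg hγ hμ σ z
  have hw := hG.pstar_mul_plan_nonneg hμ z
  have e : (G.pstar z.1 * G.plan μ z) ^ (2 - q) =
      (G.pstar z.1 * G.plan μ z) ^ (1 - q) * (G.pstar z.1 * G.plan μ z) := by
    rw [show 2 - q = (1 - q) + 1 by ring, Real.rpow_add_one' hw (by linarith)]
  have hw' : 0 ≤ (G.pstar z.1 * G.plan μ z) ^ (1 - q) := Real.rpow_nonneg hw _
  rw [e]
  set v := (G.pstar z.1 * G.plan μ z) ^ (1 - q)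
  have : v * (G.pstar z.1 * G.plan μ z) * (G.lossEst (fun _ => γ) μ σ z / G.pstar z.1) ^ 2 =
      v / G.pstar z.1 * G.lossEst (fun _ => γ) μ σ z *
        (G.plan μ z * G.lossEst (fun _ => γ) μ σ z) := by
    field_simp
  rw [this]
  exact mul_le_of_le_one_right (mul_nonneg (div_nonneg hw' hp.le) hl)
    (hG.plan_mul_lossEst_le hγ hμ σ z)

end Estimate

/-! ### Measurability of predictable quantities -/

section Measurability

open scoped Classical

variable {S X Y : Type*} [Fintype S] [Fintype X] {A : X → Type*} {B : Y → Type*}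
  [∀ x, Fintype (A x)] [∀ y, Fintype (B y)] {G : IIG S X Y A B}
  {Ω : Type*} {m : MeasurableSpace Ω} {μ : Ω → ∀ x, A x → ℝ} {ν : Ω → ∀ y, B y → ℝ}

theorem measurable_plan (hμ : Measurable μ) (z : Σ x, A x) :
    Measurable fun ω => G.plan (μ ω) z := by
  simp only [plan]
  refine Measurable.mul ?_ (measurable_policy_apply hμ _ _)
  induction G.hist z.1 with
  | nil => simp
  | cons w l ih =>
    simp only [List.map_cons, List.prod_cons]
    exact (measurable_policy_apply hμ _ _).mul ih

theorem measurable_lossEst (hμ : Measurable μ) (γ : ℕ → ℝ) (σ : G.Traj) (z : Σ x, A x) :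
    Measurable fun ω => G.lossEst γ (μ ω) σ z := by
  simp only [lossEst]
  refine Finset.measurable_fun_sum _ fun h _ => ?_
  split_ifs
  · exact ((measurable_plan hμ z).add_const _).const_div _
  · exact measurable_const

theorem measurable_occ (hν : Measurable ν) (n : ℕ) (s : S) :
    Measurable fun ω => G.occ (ν ω) n s := by
  induction n generalizing s with
  | zero => exact measurable_const
  | succ n ih =>
    simp only [occ]
    exact Finset.measurable_fun_sum _ fun c _ =>
      ((ih c.1).mul (measurable_policy_apply hν _ _)).mul_const _

theorem measurable_lossVec (hν : Measurable ν) (z : Σ x, A x) :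
    Measurable fun ω => G.lossVec (ν ω) z := by
  simp only [lossVec]
  exact Finset.measurable_fun_sum _ fun c _ =>
    ((measurable_occ hν _ _).mul (measurable_policy_apply hν _ _)).mul_const _

theorem measurable_meanEst (hμ : Measurable μ) (hν : Measurable ν) (γ : ℝ) :
    Measurable fun ω => G.meanEst γ (μ ω) (ν ω) := by
  simp only [meanEst]
  exact Finset.measurable_fun_sum _ fun z _ => (measurable_plan hμ z).mul
    (((measurable_plan hμ z).mul (measurable_lossVec hν z)).div
      ((measurable_plan hμ z).add_const _))

end Measurability

end IIG

/-- A weighted power-mean bound. -/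
theorem sum_mul_rpow_le {ι : Type*} [Fintype ι] {d w : ι → ℝ} {s c a b : ℝ} (hs0 : 0 ≤ s)
    (hs1 : s ≤ 1) (hc : 0 < c) (hd : ∀ i, 0 ≤ d i) (hw : ∀ i, 0 ≤ w i)
    (ha : ∑ i, d i ≤ a) (hb : ∑ i, d i * w i ≤ b) (hab : b = c * a) :
    ∑ i, d i * w i ^ s ≤ a * c ^ s := by
  have hcs : 0 < c ^ (1 - s) := Real.rpow_pos_of_pos hc _
  have h1 : (∑ i, d i * w i ^ s) * c ^ (1 - s) ≤ b := by
    calc (∑ i, d i * w i ^ s) * c ^ (1 - s) ≤ ∑ i, d i * (s * w i + (1 - s) * c) := by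
          rw [Finset.sum_mul]
          refine Finset.sum_le_sum fun i _ => ?_
          rw [mul_assoc]
          -- Weighted AM–GM against the constant `c`, the ratio of the two budgets, at which the
          -- bound becomes `a * c ^ s`.
          exact mul_le_mul_of_nonneg_left (Real.geom_mean_le_arith_mean2_weighted hs0
            (sub_nonneg.2 hs1) (hw i) hc.le (by ring)) (hd i)
      _ = s * ∑ i, d i * w i + (1 - s) * c * ∑ i, d i := by
          rw [Finset.mul_sum, Finset.mul_sum, ← Finset.sum_add_distrib]
          exact Finset.sum_congr rfl fun i _ => by ring
      _ ≤ s * b + (1 - s) * c * a :=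
          add_le_add (mul_le_mul_of_nonneg_left hb hs0)
            (mul_le_mul_of_nonneg_left ha (mul_nonneg (sub_nonneg.2 hs1) hc.le))
      _ = b := by rw [hab]; ring
  refine le_of_mul_le_mul_right (h1.trans (le_of_eq ?_)) hcs
  rw [mul_assoc, ← Real.rpow_add hc, add_sub_cancel, Real.rpow_one, hab, mul_comm]

/-! ### Deterministic regret bound on the good event -/

namespace IIG

section Regret

open scoped Classical

variable {S X Y : Type*} [Fintype S] [Fintype X] {A : X → Type*} {B : Y → Type*}
  [∀ x, Fintype (A x)] [∀ y, Fintype (B y)] {G : IIG S X Y A B}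

theorem PerfectRecall.regretMax_le_of_forall (hG : G.PerfectRecall) [∀ x, Nonempty (A x)] {T : ℕ}
    {μ : ℕ → ∀ x, A x → ℝ} {ν : ℕ → ∀ y, B y → ℝ} (hμ : ∀ t < T, μ t ∈ Policies A)
    (hν : ∀ t < T, ν t ∈ Policies B) {R : ℝ}
    (h : ∀ u ∈ Policies A, ∑ t ∈ Finset.range T, (∑ z, G.plan (μ t) z * G.lossVec (ν t) z -
      ∑ z, G.plan u z * G.lossVec (ν t) z) ≤ R) :
    G.regretMax T μ ν ≤ R := by
  have : Nonempty (Policies A) := (policies_nonempty (A := A)).to_subtype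
  refine ciSup_le fun u => le_trans (le_of_eq ?_) (h u u.2)
  refine Finset.sum_congr rfl fun t ht => ?_
  have ht' := Finset.mem_range.1 ht
  rw [hG.sum_plan_mul_lossVec (hμ t ht') (hν t ht'), hG.sum_plan_mul_lossVec u.2 (hν t ht')]
  ring

/-- Fallback for learning rates so large that the claimed bound exceeds `H * T`. -/
theorem PerfectRecall.regretMax_le_mul (hG : G.PerfectRecall) [∀ x, Nonempty (A x)] {T : ℕ}
    {μ : ℕ → ∀ x, A x → ℝ} {ν : ℕ → ∀ y, B y → ℝ} (hμ : ∀ t < T, μ t ∈ Policies A)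
    (hν : ∀ t < T, ν t ∈ Policies B) : G.regretMax T μ ν ≤ G.H * T := by
  refine hG.regretMax_le_of_forall hμ hν fun u hu => ?_
  refine (Finset.sum_le_card_nsmul _ _ (G.H : ℝ) fun t ht => ?_).trans (by simp [mul_comm])
  have ht' := Finset.mem_range.1 ht
  have h1 := hG.sum_plan_mul_lossVec_le (hμ t ht') (hν t ht')
  have h2 : 0 ≤ ∑ z, G.plan u z * G.lossVec (ν t) z := Finset.sum_nonneg fun z _ =>
    mul_nonneg (plan_nonneg hu z) (hG.lossVec_nonneg (hν t ht') z)
  linarith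

/-- Regret bound on the event where the three concentration inequalities hold. -/
theorem PerfectRecall.regretMax_le_of_concentration (hG : G.PerfectRecall) [∀ x, Nonempty (A x)]
    [∀ y, Nonempty (B y)] {T : ℕ} (hT : 0 < T)
    {μ : ℕ → ∀ x, A x → ℝ} {ν : ℕ → ∀ y, B y → ℝ} {τ : ℕ → G.Traj}
    (hμ : ∀ t < T, μ t ∈ Policies A) (hν : ∀ t < T, ν t ∈ Policies B)
    {ψ : ℝ → ℝ} {q κ η γ ι R : ℝ} (hψ : IsPotential ψ q κ) (hq0 : 0 ≤ q) (hq1 : q ≤ 1)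
    (hη : 0 < η) (hγ : 0 < γ) (hι : G.H * ι = 2 * G.AX * T * γ ^ 2)
    (hR : ∀ u ∈ Policies A, ∀ u' ∈ Policies A, G.potential ψ u - G.potential ψ u' ≤ R)
    (hmin : ∀ t < T, IsMinOn (fun u => ∑ z, G.plan u z *
      ∑ k ∈ Finset.range t, G.lossEst (fun _ => γ) (μ k) (τ k) z + G.potential ψ u / η)
      (Policies A) (μ t))
    (hpair : ∀ z : (Σ x, A x), ∑ t ∈ Finset.range T, 2 * γ / G.pstar z.1 *
      (G.lossEst (fun _ => γ) (μ t) (τ t) z - G.lossVec (ν t) z) ≤ ι)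
    (hdepth : ∀ h < G.H, ∑ t ∈ Finset.range T, ∑ z : (Σ x, A x) with G.depth z.1 = h,
      2 * γ * (G.pstar z.1 * G.plan (μ t) z) ^ (1 - q) / G.pstar z.1 *
      (G.lossEst (fun _ => γ) (μ t) (τ t) z - G.lossVec (ν t) z) ≤ ι)
    (hmean : ∑ t ∈ Finset.range T, (2 * γ / G.H * (G.meanEst γ (μ t) (ν t) -
      ∑ z, G.plan (μ t) z * G.lossEst (fun _ => γ) (μ t) (τ t) z) -
      (2 * γ / G.H) ^ 2 * G.H ^ 2 / 2) ≤ ι) :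
    G.regretMax T μ ν ≤ R / η + η * κ / 2 * (T * (G.AX * ((G.H : ℝ) / G.AX) ^ (1 - q)) +
      γ * G.AX * T) + 4 * (γ * G.AX * T) := by
  have : Nonempty X := G.nonempty_infoSet
  have hA : (0 : ℝ) < G.AX := Nat.cast_pos.2 AX_pos
  have hH : (0 : ℝ) < G.H := Nat.cast_pos.2 G.H_pos
  have hHA : (G.H : ℝ) ≤ G.AX := Nat.cast_le.2 hG.H_le_AX
  have hT0 : (0 : ℝ) < T := Nat.cast_pos.2 hT
  -- The choice of γ makes the deviation cost equal to the bias cost γ A_X T, the common unit of all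
  -- error terms.
  have hU : G.H * ι / (2 * γ) = γ * G.AX * T := by
    rw [hι]
    field_simp
  refine hG.regretMax_le_of_forall hμ hν fun u hu => ?_
  set est : ℕ → (Σ x, A x) → ℝ := fun t z => G.lossEst (fun _ => γ) (μ t) (τ t) z with hest
  set L : ℕ → (Σ x, A x) → ℝ := fun t z => G.lossVec (ν t) z with hL
  have hest0 : ∀ t < T, ∀ z, 0 ≤ est t z := fun t ht z => hG.lossEst_nonneg hγ (hμ t ht) _ z
  -- Bias, lower deviation for the played policies, FTRL regret on estimates, and deviation for the
  -- comparator.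
  have hdecomp : ∑ t ∈ Finset.range T, (∑ z, G.plan (μ t) z * L t z - ∑ z, G.plan u z * L t z) =
      ∑ t ∈ Finset.range T, (∑ z, G.plan (μ t) z * L t z - G.meanEst γ (μ t) (ν t)) +
      ∑ t ∈ Finset.range T, (G.meanEst γ (μ t) (ν t) - ∑ z, G.plan (μ t) z * est t z) +
      ∑ t ∈ Finset.range T, ∑ z, (G.plan (μ t) z - G.plan u z) * est t z +
      ∑ t ∈ Finset.range T, ∑ z, G.plan u z * (est t z - L t z) := by
    simp only [← Finset.sum_add_distrib]
    refine Finset.sum_congr rfl fun t _ => ?_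
    simp only [sub_mul, mul_sub, Finset.sum_sub_distrib]
    ring
  have h1 : ∑ t ∈ Finset.range T, (∑ z, G.plan (μ t) z * L t z - G.meanEst γ (μ t) (ν t)) ≤
      γ * G.AX * T := by
    refine (Finset.sum_le_card_nsmul _ _ (γ * G.AX) fun t ht => ?_).trans (by simp [mul_comm])
    have ht' := Finset.mem_range.1 ht
    exact hG.sum_plan_mul_lossVec_sub_meanEst_le hγ (hμ t ht') (hν t ht')
  have h2 : ∑ t ∈ Finset.range T, (G.meanEst γ (μ t) (ν t) - ∑ z, G.plan (μ t) z * est t z) ≤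
      2 * (γ * G.AX * T) := by
    rw [Finset.sum_sub_distrib, ← Finset.mul_sum] at hmean
    simp only [Finset.sum_const, Finset.card_range, nsmul_eq_mul] at hmean
    set D := ∑ t ∈ Finset.range T, (G.meanEst γ (μ t) (ν t) - ∑ z, G.plan (μ t) z * est t z)
    have e : D = (2 * γ / G.H * D) * (G.H / (2 * γ)) := by field_simp
    rw [e]
    have h3 : 2 * γ / G.H * D ≤ ι + T * ((2 * γ / G.H) ^ 2 * G.H ^ 2 / 2) := by linarith
    refine (mul_le_mul_of_nonneg_right h3 (by positivity)).trans ?_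
    have e2 : (ι + T * ((2 * γ / G.H) ^ 2 * G.H ^ 2 / 2)) * (G.H / (2 * γ)) =
        G.H * ι / (2 * γ) + γ * G.H * T := by
      field_simp
    rw [e2, hU]
    have : γ * G.H * T ≤ γ * G.AX * T := by gcongr
    linarith
  -- The comparator is averaged with its balanced weights of total `H`, so the bounds for single
  -- pairs suffice and no union over policies is needed.
  have h4 : ∑ t ∈ Finset.range T, ∑ z, G.plan u z * (est t z - L t z) ≤ γ * G.AX * T := by
    rw [Finset.sum_comm, ← hU, ← hG.sum_pstar_mul_plan hu, Finset.sum_mul, Finset.sum_div]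
    refine Finset.sum_le_sum fun z _ => ?_
    have hz := hpair z
    rw [← Finset.mul_sum] at hz
    rw [← Finset.mul_sum]
    have hp := hG.pstar_pos z.1
    set D := ∑ t ∈ Finset.range T, (est t z - L t z)
    have e : G.plan u z * D = G.pstar z.1 * G.plan u z * (2 * γ / G.pstar z.1 * D) / (2 * γ) := by
      field_simp
    rw [e]
    exact div_le_div_of_nonneg_right
      (mul_le_mul_of_nonneg_left hz (hG.pstar_mul_plan_nonneg hu z)) (by linarith)
  have h5 : ∑ t ∈ Finset.range T, ∑ z, (G.pstar z.1 * G.plan (μ t) z) ^ (1 - q) / G.pstar z.1 *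
      L t z ≤ T * (G.AX * ((G.H : ℝ) / G.AX) ^ (1 - q)) := by
    refine (Finset.sum_le_card_nsmul _ _ (G.AX * ((G.H : ℝ) / G.AX) ^ (1 - q))
      fun t ht => ?_).trans (by simp)
    have ht' := Finset.mem_range.1 ht
    have hb : ∑ z, L t z / G.pstar z.1 * (G.pstar z.1 * G.plan (μ t) z) ≤ G.H := by
      refine le_trans (le_of_eq (Finset.sum_congr rfl fun z _ => ?_))
        (hG.sum_plan_mul_lossVec_le (hμ t ht') (hν t ht'))
      have := hG.pstar_pos z.1
      simp only [hL]
      field_simp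
    -- Weights loss/p⋆ of mass at most A_X, and values w with weighted sum at most `H`; hence the
    -- ratio H/A_X.
    have := sum_mul_rpow_le (sub_nonneg.2 hq1) (sub_le_self 1 hq0) (div_pos hH hA)
      (fun z => div_nonneg (hG.lossVec_nonneg (hν t ht') z) (hG.pstar_pos _).le)
      (hG.pstar_mul_plan_nonneg (hμ t ht')) (hG.sum_lossVec_div_pstar_le (hν t ht'))
      hb (by field_simp)
    refine le_trans (le_of_eq (Finset.sum_congr rfl fun z _ => ?_)) this
    ring
  have h6 : ∑ t ∈ Finset.range T, ∑ z, (G.pstar z.1 * G.plan (μ t) z) ^ (1 - q) / G.pstar z.1 *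
      (est t z - L t z) ≤ γ * G.AX * T := by
    rw [← hU, le_div_iff₀' (by linarith)]
    calc _ = ∑ h ∈ Finset.range G.H, ∑ t ∈ Finset.range T, ∑ z : (Σ x, A x) with G.depth z.1 = h,
          2 * γ * (G.pstar z.1 * G.plan (μ t) z) ^ (1 - q) / G.pstar z.1 * (est t z - L t z) := by
          rw [Finset.sum_comm (s := Finset.range G.H), Finset.mul_sum]
          refine Finset.sum_congr rfl fun t _ => ?_
          rw [← hG.sum_eq_sum_depth fun z => 2 * γ * (G.pstar z.1 * G.plan (μ t) z) ^ (1 - q) /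
            G.pstar z.1 * (est t z - L t z), Finset.mul_sum]
          exact Finset.sum_congr rfl fun z _ => by ring
      _ ≤ ∑ _h ∈ Finset.range G.H, ι := Finset.sum_le_sum fun h hh =>
          hdepth h (Finset.mem_range.1 hh)
      _ = G.H * ι := by simp
  have h7 := hG.ftrl_regret_le hψ hη hT hμ hest0 hmin hu
  have h8 : ∑ t ∈ Finset.range T, ∑ z, η * κ / 2 *
      ((G.pstar z.1 * G.plan (μ t) z) ^ (2 - q) * (est t z / G.pstar z.1) ^ 2) ≤
      η * κ / 2 * (T * (G.AX * ((G.H : ℝ) / G.AX) ^ (1 - q)) + γ * G.AX * T) := by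
    have hκ := hψ.κ_pos
    calc _ ≤ ∑ t ∈ Finset.range T, ∑ z, η * κ / 2 *
          ((G.pstar z.1 * G.plan (μ t) z) ^ (1 - q) / G.pstar z.1 * est t z) :=
          Finset.sum_le_sum fun t ht => Finset.sum_le_sum fun z _ =>
            mul_le_mul_of_nonneg_left (hG.rpow_mul_sq_lossEst_le hγ hq1
              (hμ t (Finset.mem_range.1 ht)) _ z) (by positivity)
      _ = η * κ / 2 * (∑ t ∈ Finset.range T, ∑ z,
            (G.pstar z.1 * G.plan (μ t) z) ^ (1 - q) / G.pstar z.1 * L t z +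
          ∑ t ∈ Finset.range T, ∑ z, (G.pstar z.1 * G.plan (μ t) z) ^ (1 - q) / G.pstar z.1 *
            (est t z - L t z)) := by
          rw [← Finset.sum_add_distrib, Finset.mul_sum]
          refine Finset.sum_congr rfl fun t _ => ?_
          rw [← Finset.sum_add_distrib, Finset.mul_sum]
          exact Finset.sum_congr rfl fun z _ => by ring
      _ ≤ _ := mul_le_mul_of_nonneg_left (add_le_add h5 h6) (by positivity)
  have h9 := div_le_div_of_nonneg_right (hR u hu (μ 0) (hμ 0 hT)) hη.le
  rw [hdecomp]
  linarith

end Regret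

/-! ### Concentration, union bound and range of the regularizers -/

section HighProbability

open scoped Classical

variable {S X Y : Type*} [Fintype S] [Fintype X] {A : X → Type*} {B : Y → Type*}
  [∀ x, Fintype (A x)] [∀ y, Fintype (B y)] {G : IIG S X Y A B}
  {Ω : Type*} {mΩ : MeasurableSpace Ω} {P : Measure Ω} [IsProbabilityMeasure P]
  {ℱ : Filtration ℕ mΩ} {T : ℕ} {μ : ℕ → Ω → ∀ x, A x → ℝ} {ν : ℕ → Ω → ∀ y, B y → ℝ}
  {τ : ℕ → Ω → G.Traj}

/-- Concentration of weighted implicit-exploration estimates at one depth. -/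
theorem IsLearning.measureReal_ix_le [∀ x, Nonempty (A x)] (hl : G.IsLearning P ℱ T μ ν τ)
    (hG : G.PerfectRecall) {γ : ℝ} (hγ : 0 < γ) (ι : ℝ) {β : ℕ → Ω → (Σ x, A x) → ℝ}
    (hβm : ∀ t < T, ∀ z, Measurable[ℱ t] fun ω => β t ω z)
    (hβ0 : ∀ t < T, ∀ ω z, 0 ≤ β t ω z) (hβ1 : ∀ t < T, ∀ ω z, β t ω z ≤ 1) (h : Fin G.H) :
    P.real {ω | ι < ∑ t ∈ Finset.range T, ∑ z : (Σ x, A x) with G.depth z.1 = h,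
      2 * γ * β t ω z / G.pstar z.1 *
      (G.lossEst (fun _ => γ) (μ t ω) (τ t ω) z - G.lossVec (ν t ω) z)} ≤ Real.exp (-ι) := by
  refine measureReal_lt_sum_le (p := fun t ω σ => G.trajProb (μ t ω) (ν t ω) σ)
    (g := fun t ω σ => ∑ z : (Σ x, A x) with G.depth z.1 = h, 2 * γ * β t ω z / G.pstar z.1 *
      (G.lossEst (fun _ => γ) (μ t ω) σ z - G.lossVec (ν t ω) z))
    (K := (Finset.univ.filter fun z : (Σ x, A x) => G.depth z.1 = h).card • 2)
    hl.run_adapted hl.run_law ?_ ?_ ?_ ι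
  · intro t ht σ
    have hm := hl.max_predictable t ht
    have hn := hl.min_predictable t ht
    exact Finset.measurable_fun_sum _ fun z _ => (((hβm t ht z).const_mul _).div_const _).mul
      ((measurable_lossEst hm _ σ z).sub (measurable_lossVec hn z))
  · intro t ht ω σ
    refine Finset.sum_le_card_nsmul _ _ _ fun z _ => ?_
    have hp := hG.pstar_pos z.1
    have h0 := hG.lossEst_nonneg hγ (hl.max_policy t ht ω) σ z
    have hL := hG.lossVec_nonneg (hl.min_policy t ht ω) z
    have h1 := hG.lossEst_le_div hγ (hl.max_policy t ht ω) σ z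
    have hb0 := hβ0 t ht ω z
    have hb1 := hβ1 t ht ω z
    have hg : 0 ≤ γ / G.pstar z.1 * G.lossEst (fun _ => γ) (μ t ω) σ z := by positivity
    have hc : 0 ≤ 2 * γ * β t ω z / G.pstar z.1 := by positivity
    calc _ ≤ 2 * γ * β t ω z / G.pstar z.1 * G.lossEst (fun _ => γ) (μ t ω) σ z :=
          mul_le_mul_of_nonneg_left (by linarith) hc
      _ = 2 * (β t ω z * (γ / G.pstar z.1 * G.lossEst (fun _ => γ) (μ t ω) σ z)) := by ring
      _ ≤ 2 := by nlinarith
  · intro t ht ω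
    exact hG.sum_trajProb_mul_exp_ix_le hγ (hl.max_policy t ht ω) (hl.min_policy t ht ω)
      (hβ0 t ht ω) (hβ1 t ht ω) h

theorem IsLearning.measureReal_meanEst_le [∀ x, Nonempty (A x)] (hl : G.IsLearning P ℱ T μ ν τ)
    (hG : G.PerfectRecall) {γ lam : ℝ} (hγ : 0 < γ) (hlam : 0 ≤ lam) (ι : ℝ) :
    P.real {ω | ι < ∑ t ∈ Finset.range T, (lam * (G.meanEst γ (μ t ω) (ν t ω) -
      ∑ z, G.plan (μ t ω) z * G.lossEst (fun _ => γ) (μ t ω) (τ t ω) z) -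
      lam ^ 2 * G.H ^ 2 / 2)} ≤ Real.exp (-ι) := by
  refine measureReal_lt_sum_le (p := fun t ω σ => G.trajProb (μ t ω) (ν t ω) σ)
    (g := fun t ω σ => lam * (G.meanEst γ (μ t ω) (ν t ω) -
      ∑ z, G.plan (μ t ω) z * G.lossEst (fun _ => γ) (μ t ω) σ z) - lam ^ 2 * G.H ^ 2 / 2)
    (K := lam * G.H) hl.run_adapted hl.run_law ?_ ?_ ?_ ι
  · intro t ht σ
    have hm := hl.max_predictable t ht
    have hn := hl.min_predictable t ht
    exact (((measurable_meanEst hm hn γ).sub (Finset.measurable_fun_sum _ fun z _ =>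
      (measurable_plan hm z).mul (measurable_lossEst hm _ σ z))).const_mul _).sub_const _
  · intro t ht ω σ
    have h1 := hG.meanEst_le hγ (hl.max_policy t ht ω) (hl.min_policy t ht ω)
    have h2 : 0 ≤ ∑ z, G.plan (μ t ω) z * G.lossEst (fun _ => γ) (μ t ω) σ z :=
      Finset.sum_nonneg fun z _ => mul_nonneg (plan_nonneg (hl.max_policy t ht ω) z)
        (hG.lossEst_nonneg hγ (hl.max_policy t ht ω) σ z)
    have h3 : 0 ≤ lam ^ 2 * (G.H : ℝ) ^ 2 / 2 := by positivity
    have h4 := mul_le_mul_of_nonneg_left (h1.trans' (sub_le_self _ h2)) hlam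
    linarith
  · intro t ht ω
    exact hG.sum_trajProb_mul_exp_meanEst_le hγ hlam (hl.max_policy t ht ω) (hl.min_policy t ht ω)

/-- High-probability regret bound for Balanced-FTRL with a separable regularizer. -/
theorem IsLearning.measureReal_regretMax_le [∀ x, Nonempty (A x)] [∀ y, Nonempty (B y)]
    (hl : G.IsLearning P ℱ T μ ν τ) (hG : G.PerfectRecall) (hT : 0 < T)
    {ψ : ℝ → ℝ} {Ψ : ℕ → ((Σ x, A x) → ℝ) → ℝ} {q κ η γ ι R δ : ℝ}
    (hΨ : ∀ h w, Ψ h w = ∑ z : (Σ x, A x) with G.depth z.1 = h, ψ (w z))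
    (hψ : IsPotential ψ q κ) (hq0 : 0 ≤ q) (hq1 : q ≤ 1)
    (hη : 0 < η) (hγ : 0 < γ) (hι : G.H * ι = 2 * G.AX * T * γ ^ 2)
    (hδ : 3 * G.AX * Real.exp (-ι) ≤ δ)
    (hR : ∀ u ∈ Policies A, ∀ u' ∈ Policies A, G.potential ψ u - G.potential ψ u' ≤ R)
    (halg : ∀ ω, G.IsBalancedFTRL Ψ (fun _ => η) (fun _ => γ) T
      (fun t => μ t ω) (fun t => τ t ω)) :
    1 - δ ≤ P.real {ω | G.regretMax T (fun t => μ t ω) (fun t => ν t ω) ≤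
      R / η + η * κ / 2 * (T * (G.AX * ((G.H : ℝ) / G.AX) ^ (1 - q)) +
      γ * G.AX * T) + 4 * (γ * G.AX * T)} := by
  have : Nonempty X := G.nonempty_infoSet
  have hA : (0 : ℝ) < G.AX := Nat.cast_pos.2 AX_pos
  have hA1 : (1 : ℝ) ≤ G.AX := Nat.one_le_cast.2 AX_pos
  have hHA : (G.H : ℝ) ≤ G.AX := Nat.cast_le.2 hG.H_le_AX
  set good := {ω | G.regretMax T (fun t => μ t ω) (fun t => ν t ω) ≤
      R / η + η * κ / 2 * (T * (G.AX * ((G.H : ℝ) / G.AX) ^ (1 - q)) +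
      γ * G.AX * T) + 4 * (γ * G.AX * T)} with hgood
  set badPair : (Σ x, A x) → Set Ω := fun z₀ => {ω | ι < ∑ t ∈ Finset.range T,
      ∑ z : (Σ x, A x) with G.depth z.1 = G.depth z₀.1,
      2 * γ * (if z = z₀ then 1 else 0) / G.pstar z.1 *
      (G.lossEst (fun _ => γ) (μ t ω) (τ t ω) z - G.lossVec (ν t ω) z)} with hbadPair
  set badDepth : Fin G.H → Set Ω := fun h => {ω | ι < ∑ t ∈ Finset.range T,
      ∑ z : (Σ x, A x) with G.depth z.1 = h,
      2 * γ * (G.pstar z.1 * G.plan (μ t ω) z) ^ (1 - q) / G.pstar z.1 *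
      (G.lossEst (fun _ => γ) (μ t ω) (τ t ω) z - G.lossVec (ν t ω) z)} with hbadDepth
  set badMean : Set Ω := {ω | ι < ∑ t ∈ Finset.range T, (2 * γ / G.H *
      (G.meanEst γ (μ t ω) (ν t ω) -
      ∑ z, G.plan (μ t ω) z * G.lossEst (fun _ => γ) (μ t ω) (τ t ω) z) -
      (2 * γ / G.H) ^ 2 * G.H ^ 2 / 2)} with hbadMean
  have hp1 : ∀ z, P.real (badPair z) ≤ Real.exp (-ι) := fun z₀ =>
    hl.measureReal_ix_le hG hγ ι (β := fun _ _ z => if z = z₀ then 1 else 0)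
      (fun _ _ _ => measurable_const) (fun _ _ _ z => by split_ifs <;> norm_num)
      (fun _ _ _ z => by split_ifs <;> norm_num) ⟨G.depth z₀.1, hG.depth_lt _⟩
  have hp2 : ∀ h, P.real (badDepth h) ≤ Real.exp (-ι) := fun h =>
    hl.measureReal_ix_le hG hγ ι
      (β := fun t ω z => (G.pstar z.1 * G.plan (μ t ω) z) ^ (1 - q))
      (fun t ht z => ((measurable_plan (hl.max_predictable t ht) z).const_mul _).pow_const _)
      (fun t ht ω z => Real.rpow_nonneg (hG.pstar_mul_plan_nonneg (hl.max_policy t ht ω) z) _)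
      -- Balanced weights are at most one, so w^(1-q) is an admissible predictable multiplier.
      (fun t ht ω z => Real.rpow_le_one (hG.pstar_mul_plan_nonneg (hl.max_policy t ht ω) z)
        (hG.pstar_mul_plan_le_one (hl.max_policy t ht ω) z) (sub_nonneg.2 hq1)) h
  have hp3 : P.real badMean ≤ Real.exp (-ι) :=
    hl.measureReal_meanEst_le hG hγ (by positivity) ι
  -- Covering the whole space avoids any measurability requirement on the regret event.
  have hcover : Set.univ ⊆ good ∪ (((⋃ z, badPair z) ∪ ⋃ h, badDepth h) ∪ badMean) := by
    intro ω _
    by_contra hω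
    simp only [Set.mem_union, Set.mem_iUnion, not_or, not_exists] at hω
    obtain ⟨hg, ⟨h1, h2⟩, h3⟩ := hω
    refine hg (hG.regretMax_le_of_concentration (τ := fun t => τ t ω) hT
      (fun t ht => hl.max_policy t ht ω)
      (fun t ht => hl.min_policy t ht ω) hψ hq0 hq1 hη hγ hι hR ?_ ?_ ?_ (not_lt.1 h3))
    · intro t ht
      have := (halg ω t ht).2
      rw [show G.objective Ψ (fun _ => η) (G.cumLoss (fun _ => γ) (fun t => μ t ω)
        (fun t => τ t ω) t) = _ from funext fun u => hG.objective_eq hΨ η _ u] at this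
      exact this
    · intro z₀
      refine le_trans (le_of_eq (Finset.sum_congr rfl fun t _ => ?_)) (not_lt.1 (h1 z₀))
      rw [Finset.sum_eq_single_of_mem z₀ (by simp) fun z _ hne => by rw [if_neg hne]; simp]
      simp
    · exact fun h hh => not_lt.1 (h2 ⟨h, hh⟩)
  have hb1 : P.real (⋃ z, badPair z) ≤ G.AX * Real.exp (-ι) := by
    refine (measureReal_iUnion_fintype_le _).trans ?_
    refine (Finset.sum_le_card_nsmul _ _ _ fun z _ => hp1 z).trans ?_
    simp [AX]
  have hb2 : P.real (⋃ h, badDepth h) ≤ G.H * Real.exp (-ι) := by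
    refine (measureReal_iUnion_fintype_le _).trans ?_
    refine (Finset.sum_le_card_nsmul _ _ _ fun z _ => hp2 z).trans ?_
    simp
  have huniv : (1 : ℝ) ≤ P.real good + ((G.AX * Real.exp (-ι) + G.H * Real.exp (-ι)) +
      Real.exp (-ι)) := by
    calc (1 : ℝ) = P.real Set.univ := probReal_univ.symm
      _ ≤ _ := measureReal_mono hcover
      _ ≤ _ := measureReal_union_le _ _
      _ ≤ _ := add_le_add_right ((measureReal_union_le _ _).trans (add_le_add
        ((measureReal_union_le _ _).trans (add_le_add hb1 hb2)) hp3)) _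
  have he := Real.exp_pos (-ι)
  nlinarith

/-- The potential is non-positive, and the power-mean bound with unit weights limits how negative it
can be. -/
theorem PerfectRecall.potential_tsallis_sub_le [∀ x, Nonempty (A x)] [∀ y, Nonempty (B y)]
    (hG : G.PerfectRecall) {q : ℝ} (hq0 : 0 ≤ q) (hq1 : q ≤ 1) {u u' : ∀ x, A x → ℝ}
    (hu : u ∈ Policies A) (hu' : u' ∈ Policies A) :
    G.potential (fun x => -(x ^ q)) u - G.potential (fun x => -(x ^ q)) u' ≤
      G.AX * ((G.H : ℝ) / G.AX) ^ q := by
  have : Nonempty X := G.nonempty_infoSet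
  have hA : (0 : ℝ) < G.AX := Nat.cast_pos.2 AX_pos
  have hH : (0 : ℝ) < G.H := Nat.cast_pos.2 G.H_pos
  have h1 : G.potential (fun x => -(x ^ q)) u ≤ 0 := Finset.sum_nonpos fun z _ =>
    neg_nonpos.2 (Real.rpow_nonneg (hG.pstar_mul_plan_nonneg hu z) _)
  have h2 := sum_mul_rpow_le (d := fun _ : (Σ x, A x) => 1)
    (w := fun z => G.pstar z.1 * G.plan u' z) hq0 hq1 (div_pos hH hA) (fun _ => zero_le_one)
    (hG.pstar_mul_plan_nonneg hu') (a := G.AX) (b := G.H) (by simp [AX])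
    (by simp only [one_mul]; exact (hG.sum_pstar_mul_plan hu').le) (by field_simp)
  simp only [one_mul] at h2
  have h3 : G.potential (fun x => -(x ^ q)) u' = -∑ z, (G.pstar z.1 * G.plan u' z) ^ q := by
    simp [potential]
  linarith

theorem PerfectRecall.potential_shannon_sub_le [∀ x, Nonempty (A x)] [∀ y, Nonempty (B y)]
    (hG : G.PerfectRecall) {u u' : ∀ x, A x → ℝ}
    (hu : u ∈ Policies A) (hu' : u' ∈ Policies A) :
    G.potential (fun x => x * Real.log x) u - G.potential (fun x => x * Real.log x) u' ≤
      G.H * Real.log G.AX := by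
  have : Nonempty X := G.nonempty_infoSet
  have hA : (0 : ℝ) < G.AX := Nat.cast_pos.2 AX_pos
  have hH : (1 : ℝ) ≤ G.H := Nat.one_le_cast.2 G.H_pos
  have h1 : G.potential (fun x => x * Real.log x) u ≤ 0 := Finset.sum_nonpos fun z _ =>
    Real.mul_log_nonpos (hG.pstar_mul_plan_nonneg hu z) (hG.pstar_mul_plan_le_one hu z)
  have h2 : -G.potential (fun x => x * Real.log x) u' ≤
      ∑ z : (Σ x, A x), (G.pstar z.1 * G.plan u' z * Real.log G.AX + 1 / G.AX -
        G.pstar z.1 * G.plan u' z) := by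
    rw [potential, ← Finset.sum_neg_distrib]
    refine Finset.sum_le_sum fun z _ => ?_
    rcases (hG.pstar_mul_plan_nonneg hu' z).eq_or_lt with h0 | hpos
    · rw [← h0]
      simp
    · set w := G.pstar z.1 * G.plan u' z
      -- log x ≤ x - 1 at x = 1/(w A_X), a comparison with the uniform weight. Summation leaves 1 -
      -- H ≤ 0 besides H log A_X.
      have := mul_le_mul_of_nonneg_left
        (Real.log_le_sub_one_of_pos (x := 1 / (w * G.AX)) (by positivity)) hpos.le
      rw [Real.log_div one_ne_zero (by positivity), Real.log_mul hpos.ne' hA.ne',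
        Real.log_one] at this
      have e : w * (1 / (w * G.AX) - 1) = 1 / G.AX - w := by field_simp
      rw [e] at this
      linarith
  have h3 : ∑ z : (Σ x, A x), (G.pstar z.1 * G.plan u' z * Real.log G.AX + 1 / G.AX -
        G.pstar z.1 * G.plan u' z) = G.H * Real.log G.AX + 1 - G.H := by
    rw [Finset.sum_sub_distrib, Finset.sum_add_distrib, ← Finset.sum_mul,
      hG.sum_pstar_mul_plan hu', Finset.sum_const, Finset.card_univ, nsmul_eq_mul]
    change G.H * Real.log G.AX + (G.AX : ℝ) * (1 / G.AX) - G.H = _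
    field_simp
  linarith

end HighProbability

end IIG

/-! ### Tuning of the learning rates -/

/-- The learning rate of the Tsallis version balances the two terms of the regret bound. -/
theorem tsallis_rate {a H T q η : ℝ} (ha : 0 < a) (hH : 0 < H) (hHa : H ≤ a) (hT : 0 < T)
    (hq0 : 0 < q) (hq1 : q < 1) (hη : η = √(2 * q * (1 - q) / T) * (H / a) ^ (q - 1 / 2)) :
    0 < η ∧
    a * (H / a) ^ q / η + η * (1 / (q * (1 - q))) / 2 * (T * (a * (H / a) ^ (1 - q))) =
      √(2 / (q * (1 - q))) * √(H * a * T) ∧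
    (η * (1 / (q * (1 - q))) / 2 ≤ 2 ∨ H * T ≤ √(2 / (q * (1 - q))) * √(H * a * T)) := by
  obtain ⟨c, hc⟩ : ∃ c, c = H / a := ⟨_, rfl⟩
  obtain ⟨k, hk⟩ : ∃ k, k = q * (1 - q) := ⟨_, rfl⟩
  have hk0 : 0 < k := hk ▸ mul_pos hq0 (by linarith)
  have hc0 : 0 < c := hc ▸ div_pos hH ha
  have hc1 : c ≤ 1 := hc ▸ (div_le_one ha).2 hHa
  have hHc : H = c * a := by rw [hc]; field_simp
  rw [show 2 * q * (1 - q) = 2 * k by rw [hk]; ring, ← hc] at hη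
  rw [← hc, ← hk]
  obtain ⟨D, hD⟩ : ∃ D, D = √(2 * k / T) := ⟨_, rfl⟩
  obtain ⟨r, hr⟩ : ∃ r, r = √c := ⟨_, rfl⟩
  have hD0 : 0 < D := hD ▸ Real.sqrt_pos.2 (by positivity)
  have hD2 : D ^ 2 * T = 2 * k := by
    rw [hD, Real.sq_sqrt (by positivity)]
    field_simp
  have hr0 : 0 < r := hr ▸ Real.sqrt_pos.2 hc0
  have hr2 : r ^ 2 = c := by rw [hr, Real.sq_sqrt hc0.le]
  rw [← hD] at hη
  have hp : 0 < c ^ (q - 1 / 2) := Real.rpow_pos_of_pos hc0 _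
  have hη0 : 0 < η := hη ▸ mul_pos hD0 hp
  have hmain : √(2 / k) * √(H * a * T) = 2 * a * r / D := by
    rw [← Real.sqrt_mul (by positivity), Real.sqrt_eq_iff_mul_self_eq (by positivity) (by positivity)]
    have : k = D ^ 2 * T / 2 := by linarith
    rw [hHc, this, ← hr2]
    field_simp
  have e1 : c ^ q = c ^ (q - 1 / 2) * r := by
    rw [hr, Real.sqrt_eq_rpow, ← Real.rpow_add hc0]
    norm_num
  have e2 : c ^ (q - 1 / 2) * c ^ (1 - q) = r := by
    rw [hr, Real.sqrt_eq_rpow, ← Real.rpow_add hc0]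
    norm_num
  refine ⟨hη0, ?_, ?_⟩
  · rw [hmain]
    have t1 : a * c ^ q / η = a * r / D := by
      rw [e1, hη]
      field_simp
    have t2 : η * (1 / k) / 2 * (T * (a * c ^ (1 - q))) = a * r / D := by
      have : η * (1 / k) / 2 * (T * (a * c ^ (1 - q))) =
          D * T * a * (c ^ (q - 1 / 2) * c ^ (1 - q)) / (2 * k) := by
        rw [hη]
        ring
      rw [this, e2, ← hD2]
      field_simp
    rw [t1, t2]
    ring
  · rcases le_or_gt (η * (1 / k) / 2) 2 with h | h
    · exact Or.inl h
    · right
      -- Since `c ≤ 1` and `q > 0`, the exponent can be lowered to -1/2.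
      have h1 : c ^ (q - 1 / 2) ≤ r⁻¹ := by
        rw [hr, Real.sqrt_eq_rpow, ← Real.rpow_neg hc0.le]
        exact Real.rpow_le_rpow_of_exponent_ge hc0 hc1 (by linarith)
      have h2 : 4 * k < η := by
        have : η * (1 / k) / 2 = η / (2 * k) := by field_simp
        rw [this, lt_div_iff₀ (by positivity)] at h
        linarith
      have h3 : η ≤ D * r⁻¹ := hη ▸ mul_le_mul_of_nonneg_left h1 hD0.le
      have h4 : 4 * k * r < D := by
        have := mul_lt_mul_of_pos_right (h2.trans_le h3) hr0
        rwa [mul_assoc D, inv_mul_cancel₀ hr0.ne', mul_one] at this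
      rw [hmain, le_div_iff₀ hD0, hHc, ← hr2]
      -- Multiply `4 * k * r < D` by `T * D` and use `D ^ 2 * T = 2 * k`; the constant 2 is
      -- generous.
      have h5 : r * T * D ≤ 2 := by
        have : 4 * k * (r * T * D) ≤ 4 * k * 2 := by
          calc 4 * k * (r * T * D) = 4 * k * r * (T * D) := by ring
            _ ≤ D * (T * D) := mul_le_mul_of_nonneg_right h4.le (by positivity)
            _ = 2 * k := by rw [← hD2]; ring
            _ ≤ 4 * k * 2 := by linarith
        exact le_of_mul_le_mul_left this (by positivity)
      calc r ^ 2 * a * T * D = a * r * (r * T * D) := by ring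
        _ ≤ a * r * 2 := mul_le_mul_of_nonneg_left h5 (by positivity)
        _ = 2 * a * r := by ring

/-- The learning rate of the Shannon version balances the two terms of the regret bound. -/
theorem shannon_rate {a H T l η : ℝ} (ha : 0 < a) (hH : 0 < H) (hHa : H ≤ a) (hT : 0 < T)
    (hl : 0 < l) (hη : η = √(2 * H * l / (a * T))) :
    0 < η ∧
    H * l / η + η * 1 / 2 * (T * (a * (H / a) ^ ((1 : ℝ) - 1))) = √(2 * l) * √(H * a * T) ∧
    (η * 1 / 2 ≤ 2 ∨ H * T ≤ √(2 * l) * √(H * a * T)) := by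
  have hη0 : 0 < η := hη ▸ Real.sqrt_pos.2 (by positivity)
  have hη2 : η ^ 2 * (a * T) = 2 * H * l := by
    rw [hη, Real.sq_sqrt (by positivity)]
    field_simp
  have hmain : √(2 * l) * √(H * a * T) = η * a * T := by
    rw [← Real.sqrt_mul (by positivity), Real.sqrt_eq_iff_mul_self_eq (by positivity) (by positivity)]
    linear_combination (-a * T) * hη2
  refine ⟨hη0, ?_, ?_⟩
  · have : H * l / η = η * a * T / 2 := by
      rw [div_eq_iff hη0.ne']
      linear_combination -hη2 / 2
    rw [hmain, this, sub_self, Real.rpow_zero]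
    ring
  · rcases le_or_gt (η * 1 / 2) 2 with h | h
    · exact Or.inl h
    · right
      rw [hmain]
      -- Here `η > 4`, so `H ≤ a` is more than enough.
      have : H ≤ η * a := by nlinarith
      exact mul_le_mul_of_nonneg_right this hT.le

/-! ### Final assembly and degenerate cases -/

namespace IIG

variable {S X Y : Type*} [Fintype S] [Fintype X] {A : X → Type*} {B : Y → Type*}
  [∀ x, Fintype (A x)] [∀ y, Fintype (B y)] {G : IIG S X Y A B}
  {Ω : Type*} {mΩ : MeasurableSpace Ω} {P : Measure Ω} [IsProbabilityMeasure P]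
  {ℱ : Filtration ℕ mΩ} {T : ℕ} {μ : ℕ → Ω → ∀ x, A x → ℝ} {ν : ℕ → Ω → ∀ y, B y → ℝ}
  {τ : ℕ → Ω → G.Traj}

open scoped Classical in
/-- The high-probability bound, once the main terms are known to be `M` and either the learning
rate is small or the bound is trivial. -/
theorem IsLearning.measureReal_regretMax_le_of_rate [∀ x, Nonempty (A x)] [∀ y, Nonempty (B y)]
    (hl : G.IsLearning P ℱ T μ ν τ) (hG : G.PerfectRecall) (hT : 0 < T)
    {ψ : ℝ → ℝ} {Ψ : ℕ → ((Σ x, A x) → ℝ) → ℝ} {q κ η γ ι R δ M : ℝ}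
    (hδ0 : 0 < δ) (hδ1 : δ < 1) (hι : ι = Real.log (3 * G.AX / δ))
    (hγ : γ = √(G.H * ι / (2 * G.AX * T)))
    (hΨ : ∀ h w, Ψ h w = ∑ z : (Σ x, A x) with G.depth z.1 = h, ψ (w z))
    (hψ : IsPotential ψ q κ) (hq0 : 0 ≤ q) (hq1 : q ≤ 1) (hη : 0 < η)
    (hR : ∀ u ∈ Policies A, ∀ u' ∈ Policies A, G.potential ψ u - G.potential ψ u' ≤ R)
    (halg : ∀ ω, G.IsBalancedFTRL Ψ (fun _ => η) (fun _ => γ) T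
      (fun t => μ t ω) (fun t => τ t ω))
    (hM : R / η + η * κ / 2 * (T * (G.AX * ((G.H : ℝ) / G.AX) ^ (1 - q))) =
      M * √(G.H * G.AX * T))
    (hrate : η * κ / 2 ≤ 2 ∨ G.H * T ≤ M * √(G.H * G.AX * T)) :
    1 - δ ≤ P.real {ω | G.regretMax T (fun t => μ t ω) (fun t => ν t ω) ≤
        (M + 3 * √(2 * ι)) * √(G.H * G.AX * T)} := by
  have : Nonempty X := G.nonempty_infoSet
  have hA : (0 : ℝ) < G.AX := Nat.cast_pos.2 AX_pos
  have hA1 : (1 : ℝ) ≤ G.AX := Nat.one_le_cast.2 AX_pos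
  have hH : (0 : ℝ) < G.H := Nat.cast_pos.2 G.H_pos
  have hT0 : (0 : ℝ) < T := Nat.cast_pos.2 hT
  have hι0 : 0 < ι := by
    rw [hι]
    refine Real.log_pos ?_
    rw [lt_div_iff₀ hδ0]
    linarith
  have hγ0 : 0 < γ := hγ ▸ Real.sqrt_pos.2 (by positivity)
  have hγ2 : G.H * ι = 2 * G.AX * T * γ ^ 2 := by
    rw [hγ, Real.sq_sqrt (by positivity)]
    field_simp
  -- Six units: one for bias, two for the played losses, one for the comparator, and at most two
  -- from the stability term, whose coefficient is `η * κ / 2`.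
  have hU : 3 * √(2 * ι) * √(G.H * G.AX * T) = 6 * (γ * G.AX * T) := by
    rw [mul_assoc, ← Real.sqrt_mul (by positivity),
      (Real.sqrt_eq_iff_mul_self_eq (y := 2 * (γ * G.AX * T)) (by positivity) (by positivity)).2]
    · ring
    · linear_combination (2 * G.AX * T) * hγ2
  have hU0 : 0 < γ * G.AX * T := by positivity
  rcases hrate with hrate | hrate
  · have hδ : 3 * G.AX * Real.exp (-ι) ≤ δ := by
      rw [hι, Real.exp_neg, Real.exp_log (by positivity)]
      refine le_of_eq ?_
      field_simp
    refine (hl.measureReal_regretMax_le hG hT hΨ hψ hq0 hq1 hη hγ0 hγ2 hδ hR halg).trans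
      (measureReal_mono fun ω hω => ?_)
    refine le_trans (Set.mem_ofPred_eq ▸ hω) ?_
    rw [add_mul, hU, ← hM]
    have := mul_le_mul_of_nonneg_right hrate hU0.le
    linarith
  · have : {ω | G.regretMax T (fun t => μ t ω) (fun t => ν t ω) ≤
        (M + 3 * √(2 * ι)) * √(G.H * G.AX * T)} = Set.univ := by
      refine Set.eq_univ_of_forall fun ω => ?_
      have := hG.regretMax_le_mul (fun t ht => hl.max_policy t ht ω)
        (fun t ht => hl.min_policy t ht ω)
      refine le_trans this ?_
      rw [add_mul, hU]
      linarith
    rw [this, probReal_univ]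
    linarith

/-- The game does not require actions to exist; a policy actually played does, as the empty sum is
not one. -/
theorem IsLearning.nonempty_max (hl : G.IsLearning P ℱ T μ ν τ) (hT : 0 < T) (x : X) :
    Nonempty (A x) := by
  obtain ⟨ω⟩ : Nonempty Ω := nonempty_of_isProbabilityMeasure P
  by_contra hcon
  rw [not_nonempty_iff] at hcon
  simpa using (hl.max_policy 0 hT ω x).2

theorem IsLearning.nonempty_min (hl : G.IsLearning P ℱ T μ ν τ) (hT : 0 < T) (y : Y) :
    Nonempty (B y) := by
  obtain ⟨ω⟩ : Nonempty Ω := nonempty_of_isProbabilityMeasure P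
  by_contra hcon
  rw [not_nonempty_iff] at hcon
  simpa using (hl.min_policy 0 hT ω y).2

theorem regretMax_zero (μ : ℕ → ∀ x, A x → ℝ) (ν : ℕ → ∀ y, B y → ℝ) :
    G.regretMax 0 μ ν = 0 := by
  simp [regretMax]

/-- Needed for the Shannon version, where log A_X = 0 makes the learning rate zero. -/
theorem policies_subsingleton (h : G.AX = 1) : (Policies A).Subsingleton := by
  have : Subsingleton (Σ x, A x) := Fintype.card_le_one_iff_subsingleton.1 h.le
  intro μ hμ μ' hμ'
  funext x a
  have hu : ∀ b, b = a := fun b => by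
    have := Subsingleton.elim (⟨x, b⟩ : Σ x, A x) ⟨x, a⟩
    simpa using this
  have hone : ∀ m ∈ Policies A, m x a = 1 := fun m hm => by
    rw [← (hm x).2]
    exact (Fintype.sum_eq_single a fun b hb => absurd (hu b) hb).symm
  rw [hone μ hμ, hone μ' hμ']

end IIG

theorem theorem3 {S X Y : Type*} [Fintype S] [Fintype X] [Fintype Y]
    {A : X → Type*} {B : Y → Type*} [∀ x, Fintype (A x)] [∀ y, Fintype (B y)]
    (G : IIG S X Y A B) (hG : G.PerfectRecall)
    {Ω : Type*} {mΩ : MeasurableSpace Ω} (P : Measure Ω) [IsProbabilityMeasure P]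
    (ℱ : Filtration ℕ mΩ) (T : ℕ)
    (μ : ℕ → Ω → ∀ x, A x → ℝ) (ν : ℕ → Ω → ∀ y, B y → ℝ) (τ : ℕ → Ω → G.Traj)
    (hlearn : G.IsLearning P ℱ T μ ν τ)
    (δ : ℝ) (hδ0 : 0 < δ) (hδ1 : δ < 1)
    (ι : ℝ) (hι : ι = Real.log (3 * G.AX / δ))
    (γ : ℝ) (hγ : γ = √(G.H * ι / (2 * G.AX * T))) :
    (∀ q η : ℝ, 0 < q → q < 1 →
      η = √(2 * q * (1 - q) / T) * ((G.H : ℝ) / G.AX) ^ (q - 1 / 2) →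
      (∀ ω, G.IsBalancedFTRL (G.tsallis q) (fun _ => η) (fun _ => γ) T
        (fun t => μ t ω) (fun t => τ t ω)) →
      1 - δ ≤ P.real {ω | G.regretMax T (fun t => μ t ω) (fun t => ν t ω) ≤
        (√(2 / (q * (1 - q))) + 3 * √(2 * ι)) * √(G.H * G.AX * T)}) ∧
    (∀ η : ℝ, η = √(2 * G.H * Real.log G.AX / (G.AX * T)) →
      (∀ ω, G.IsBalancedFTRL G.shannon (fun _ => η) (fun _ => γ) T
        (fun t => μ t ω) (fun t => τ t ω)) →
      1 - δ ≤ P.real {ω | G.regretMax T (fun t => μ t ω) (fun t => ν t ω) ≤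
        (√(2 * Real.log G.AX) + 3 * √(2 * ι)) * √(G.H * G.AX * T)}) := by
  have htriv : ∀ {M : ℝ}, 0 ≤ M →
      (∀ ω, G.regretMax T (fun t => μ t ω) (fun t => ν t ω) ≤ 0) →
      1 - δ ≤ P.real {ω | G.regretMax T (fun t => μ t ω) (fun t => ν t ω) ≤
        (M + 3 * √(2 * ι)) * √(G.H * G.AX * T)} := by
    intro M hM h
    have hpos : 0 ≤ (M + 3 * √(2 * ι)) * √(G.H * G.AX * T) := by positivity
    have huniv : {ω | G.regretMax T (fun t => μ t ω) (fun t => ν t ω) ≤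
        (M + 3 * √(2 * ι)) * √(G.H * G.AX * T)} = Set.univ :=
      Set.eq_univ_of_forall fun ω => (h ω).trans hpos
    rw [huniv, probReal_univ]
    linarith
  rcases Nat.eq_zero_or_pos T with rfl | hT
  · have h0 : ∀ ω, G.regretMax 0 (fun t => μ t ω) (fun t => ν t ω) ≤ 0 := fun ω =>
      (IIG.regretMax_zero _ _).le
    exact ⟨fun q η _ _ _ _ => htriv (Real.sqrt_nonneg _) h0,
      fun η _ _ => htriv (Real.sqrt_nonneg _) h0⟩
  have : ∀ x, Nonempty (A x) := hlearn.nonempty_max hT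
  have : ∀ y, Nonempty (B y) := hlearn.nonempty_min hT
  have : Nonempty X := G.nonempty_infoSet
  have hA : (0 : ℝ) < G.AX := Nat.cast_pos.2 IIG.AX_pos
  have hH : (0 : ℝ) < G.H := Nat.cast_pos.2 G.H_pos
  have hHA : (G.H : ℝ) ≤ G.AX := Nat.cast_le.2 hG.H_le_AX
  have hT0 : (0 : ℝ) < T := Nat.cast_pos.2 hT
  refine ⟨fun q η hq0 hq1 hη halg => ?_, fun η hη halg => ?_⟩
  · obtain ⟨hη0, hM, hrate⟩ := tsallis_rate hA hH hHA hT0 hq0 hq1 hη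
    refine hlearn.measureReal_regretMax_le_of_rate hG hT hδ0 hδ1 hι hγ (fun h w => ?_)
      (isPotential_tsallis hq0 hq1) hq0.le hq1.le hη0
      (fun u hu u' hu' => hG.potential_tsallis_sub_le hq0.le hq1.le hu hu') halg hM hrate
    simp [IIG.tsallis]
  -- If A_X = 1 then η = 0 and the regularization term is a division by zero, but the only policy
  -- has zero regret.
  · rcases (Nat.one_le_iff_ne_zero.2 (IIG.AX_pos (A := A) (G := G)).ne').eq_or_lt with h1 | h1
    · refine htriv (Real.sqrt_nonneg _) fun ω => hG.regretMax_le_of_forall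
        (fun t ht => hlearn.max_policy t ht ω) (fun t ht => hlearn.min_policy t ht ω)
        fun u hu => le_of_eq (Finset.sum_eq_zero fun t ht => ?_)
      rw [IIG.policies_subsingleton h1.symm (hlearn.max_policy t (Finset.mem_range.1 ht) ω) hu,
        sub_self]
    · have hlog : 0 < Real.log G.AX := Real.log_pos (Nat.one_lt_cast.2 h1)
      obtain ⟨hη0, hM, hrate⟩ := shannon_rate hA hH hHA hT0 hlog hη
      exact hlearn.measureReal_regretMax_le_of_rate hG hT hδ0 hδ1 hι hγ (fun h w => rfl)
        isPotential_shannon zero_le_one le_rfl hη0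
        (fun u hu u' hu' => hG.potential_shannon_sub_le hu hu') halg hM hrate
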